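/- Consider arcs of great circles on the unit sphere in $\mathbb{R}^3$. An arc $a$ is said to feed into an arc $a'$ if an endpoint of $a$ lies in the relative interior of $a'$. A spherical occlusion diagram (SOD) is a finite non-empty set of arcs of great circles such that: (A1') each arc is shorter than a great semicircle, and any two arcs are internally disjoint (i.e. have disjoint relative interiors); (A2) each arc feeds into two arcs; (A3) all arcs that feed into the same arc reach it from the same side. A swirl of a SOD is a cycle of arcs of the SOD such that each arc feeds into the next, going always clockwise or always counterclockwise. Every SOD has at least eight arcs. This bound is tight: there is a SOD with exactly eight arcs, and exactly four swirls. -/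

import Mathlib

/-- Euclidean three-space; the sphere of the diagrams is its unit sphere centred at the origin. -/
abbrev E3 : Type := EuclideanSpace ℝ (Fin 3)

/-- The triple product `x · (y × z)`, i.e. the determinant with rows `x`, `y`, `z`. -/
def triple (x y z : E3) : ℝ :=
  Matrix.det !![x 0, x 1, x 2; y 0, y 1, y 2; z 0, z 1, z 2]

/-- An arc of a great circle of the unit sphere that is shorter than a great semicircle, given by
its two endpoints, which are distinct, non-antipodal unit vectors. The endpoints are listed in an
order, which serves only to speak of the direction in which the arc is traversed. -/
@[ext]
structure GreatArc where
  tail : E3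
  head : E3
  norm_tail : ‖tail‖ = 1
  norm_head : ‖head‖ = 1
  ne : tail ≠ head
  ne_neg : tail ≠ -head

namespace GreatArc

/-- The same arc, traversed in the opposite direction. -/
def reverse (a : GreatArc) : GreatArc where
  tail := a.head
  head := a.tail
  norm_tail := a.norm_head
  norm_head := a.norm_tail
  ne := a.ne.symm
  ne_neg := fun h => a.ne_neg (by rw [h, neg_neg])

/-- The relative interior of an arc: the arc without its two endpoints. -/
def relInterior (a : GreatArc) : Set E3 :=
  {x | ‖x‖ = 1 ∧ ∃ s t : ℝ, 0 < s ∧ 0 < t ∧ x = s • a.tail + t • a.head}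

/-- `a` feeds into `b`: an endpoint of `a` is in the relative interior of `b`. -/
def FeedsInto (a b : GreatArc) : Prop :=
  a.tail ∈ b.relInterior ∨ a.head ∈ b.relInterior

/-- The open hemisphere on the left of `b`, when `b` is traversed from tail to head and the sphere
is seen from outside. -/
def leftSide (b : GreatArc) : Set E3 :=
  {x | ‖x‖ = 1 ∧ 0 < triple b.tail b.head x}

/-- The open hemisphere on the right of `b`. -/
def rightSide (b : GreatArc) : Set E3 :=
  {x | ‖x‖ = 1 ∧ triple b.tail b.head x < 0}

/-- The traversal of `a` ends in the relative interior of `b`, and continues along `b`, towards the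
head of `b`, after a left turn. -/
def TurnsLeftInto (a b : GreatArc) : Prop :=
  a.head ∈ b.relInterior ∧ b.head ∈ a.leftSide

/-- The traversal of `a` ends in the relative interior of `b`, and continues along `b`, towards the
head of `b`, after a right turn. -/
def TurnsRightInto (a b : GreatArc) : Prop :=
  a.head ∈ b.relInterior ∧ b.head ∈ a.rightSide

end GreatArc

/-- Spherical occlusion diagrams. Since distinct members of `S` are internally disjoint, no arc is
listed in both directions, so that `S.card` is the number of arcs. -/
structure IsSOD (S : Finset GreatArc) : Prop where
  nonempty : S.Nonempty
  /-- Any two arcs are internally disjoint (each is shorter than a great semicircle by the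
  definition of `GreatArc`). -/
  internally_disjoint : ∀ a ∈ S, ∀ b ∈ S, a ≠ b → Disjoint a.relInterior b.relInterior
  /-- Each arc feeds into two arcs. -/
  feeds_two : ∀ a ∈ S, {b : GreatArc | b ∈ S ∧ a.FeedsInto b}.ncard = 2
  /-- All arcs that feed into the same arc reach it from the same side. -/
  same_side : ∀ b ∈ S,
    (∀ a ∈ S, a.FeedsInto b → a.relInterior ⊆ b.leftSide) ∨
    (∀ a ∈ S, a.FeedsInto b → a.relInterior ⊆ b.rightSide)

/-- A swirl of `S`: a cycle of arcs of `S`, each traversed in one of its two directions, such that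
each arc feeds into the next, turning always left (counterclockwise) or always right (clockwise).
A `Cycle` is a list up to rotation. -/
def IsSwirl (S : Finset GreatArc) (C : Cycle GreatArc) : Prop :=
  C ≠ Cycle.nil ∧ C.Nodup ∧ (∀ a ∈ C, a ∈ S ∨ a.reverse ∈ S) ∧
    (C.Chain GreatArc.TurnsLeftInto ∨ C.Chain GreatArc.TurnsRightInto)

open Filter Topology

/-! Orient every arc so that the arcs feeding into it come from its right, and let `f` and `g` give
the arcs that contain its head and its tail. A walk that runs to the head and continues along `f`
always turns right; a walk that runs back to the tail and continues along `g` always turns left. So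
clockwise swirls are cycles of `f` and counterclockwise swirls are cycles of `g`. Point reflection
together with reversal of all arcs exchanges the two maps (`ArcSystem.dual`).

The crux is `exists_iterate_ne`: for every arc `c`, some walk along `f` never meets `c`. Look from a
point `k` just to the right of `c`, beside a point `z` of `c` that is nearer to the head than any
arc endpoint inside `c`. Traversing arcs counterclockwise about `k` leads to closed paths. A walk
along `f` that starts on such a path never crosses the paths towards `k` (`segment_mem_below`), so
if it met `c`, it would pass `z`, and `z` would lie on or behind a path. It is not behind one, as no
arc separates `z` from the nearby `k`. Nor is it on one: counterclockwise about `k` means from head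
to tail on `c`, and a path through `z` would have to join `c` between its head and `z`, where no arc
ends.

Hence `f` has two disjoint cycles, and so has `g` (`exists_two_cycles`). All have length at least 3,
and a cycle of `f` and a cycle of `g`, one of length 3 and the other of length at most 4, share at
most one arc (`card_inter_le_one`). These facts cannot all hold with seven arcs or fewer.

For sharpness, eight arcs with integer directions are checked by computation. There every orbit of
`f` and of `g` ends in one of two 3-cycles, which gives the four swirls (`isSwirl_iff`). -/

theorem triple_apply (x y z : E3) : triple x y z =
    x 0 * (y 1 * z 2 - y 2 * z 1) - x 1 * (y 0 * z 2 - y 2 * z 0)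
      + x 2 * (y 0 * z 1 - y 1 * z 0) := by
  simp [triple, Matrix.det_fin_three]; ring

theorem triple_cycle (x y z : E3) : triple x y z = triple y z x := by
  simp only [triple_apply]; ring

theorem triple_swap (x y z : E3) : triple y x z = -triple x y z := by
  simp only [triple_apply]; ring

theorem triple_lin (x y u v : E3) (s t : ℝ) :
    triple x y (s • u + t • v) = s * triple x y u + t * triple x y v := by
  simp only [triple_apply, PiLp.add_apply, PiLp.smul_apply, smul_eq_mul]; ring

theorem triple_self_left (x y : E3) : triple x y x = 0 := by
  simp only [triple_apply]; ring

theorem triple_self_right (x y : E3) : triple x y y = 0 := by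
  simp only [triple_apply]; ring

theorem triple_lin_mid (x y u v : E3) (s t : ℝ) :
    triple x (s • u + t • v) y = s * triple x u y + t * triple x v y := by
  simp only [triple_apply, PiLp.add_apply, PiLp.smul_apply, smul_eq_mul]; ring

theorem triple_lin_left (x y u v : E3) (s t : ℝ) :
    triple (s • u + t • v) x y = s * triple u x y + t * triple v x y := by
  simp only [triple_apply, PiLp.add_apply, PiLp.smul_apply, smul_eq_mul]; ring

/-- Cramer's rule. -/
theorem triple_cramer (x y z w : E3) : triple x y z • w =
    triple w y z • x + triple x w z • y + triple x y w • z := by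
  ext i
  fin_cases i <;>
    simp only [triple_apply, PiLp.add_apply, PiLp.smul_apply, smul_eq_mul, Fin.zero_eta,
      Fin.mk_one, Fin.reduceFinMk] <;> ring

theorem continuous_triple (x y : E3) : Continuous fun z => triple x y z := by
  simp only [triple_apply]; fun_prop

/-! ### Systems of oriented arcs and their forbidden short patterns -/

/-- The combinatorial and geometric data of a spherical occlusion diagram, each arc oriented so
that the arcs feeding into it come from its right: `f` and `g` say which arc contains the head and
the tail of a given arc. Points of the sphere are represented by arbitrary positive multiples. -/
structure ArcSystem (ι : Type*) where
  T : ι → E3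
  H : ι → E3
  f : ι → ι
  g : ι → ι
  head_mem : ∀ a, ∃ s t : ℝ, 0 < s ∧ 0 < t ∧ H a = s • T (f a) + t • H (f a)
  tail_mem : ∀ a, ∃ s t : ℝ, 0 < s ∧ 0 < t ∧ T a = s • T (g a) + t • H (g a)
  head_side : ∀ a, triple (T (f a)) (H (f a)) (T a) < 0
  tail_side : ∀ a, triple (T (g a)) (H (g a)) (H a) < 0
  disjoint : ∀ a b (s t s' t' : ℝ), 0 < s → 0 < t → 0 < s' → 0 < t' →
    s • T a + t • H a = s' • T b + t' • H b → a = b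

namespace ArcSystem

variable {ι : Type*} (A : ArcSystem ι)

/-- The mirror image of a system of arcs. -/
def dual : ArcSystem ι where
  T a := -A.H a
  H a := -A.T a
  f := A.g
  g := A.f
  head_mem a := by
    obtain ⟨s, t, hs, ht, h⟩ := A.tail_mem a
    exact ⟨t, s, ht, hs, by rw [h]; module⟩
  tail_mem a := by
    obtain ⟨s, t, hs, ht, h⟩ := A.head_mem a
    exact ⟨t, s, ht, hs, by rw [h]; module⟩
  head_side a := by
    have h := A.tail_side a
    simp only [triple_apply, PiLp.neg_apply] at h ⊢
    linarith
  tail_side a := by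
    have h := A.head_side a
    simp only [triple_apply, PiLp.neg_apply] at h ⊢
    linarith
  disjoint a b s t s' t' hs ht hs' ht' h :=
    A.disjoint a b t s t' s' ht hs ht' hs' (by
      have h2 := congrArg Neg.neg h
      simp only [smul_neg, neg_add, neg_neg] at h2
      rw [add_comm, h2, add_comm])

/-- The plane of `f a` contains the head but not the tail, and the plane of `g a` the tail but not
the head; each kills one coefficient. -/
theorem indep (a : ι) {s t : ℝ} (h : s • A.T a + t • A.H a = 0) : s = 0 ∧ t = 0 := by
  obtain ⟨u, v, -, -, hH⟩ := A.head_mem a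
  obtain ⟨u', v', -, -, hT⟩ := A.tail_mem a
  constructor
  · have h1 : triple (A.T (A.f a)) (A.H (A.f a)) (s • A.T a + t • A.H a) = 0 := by
      rw [h]; simp [triple_apply]
    rw [triple_lin, hH, triple_lin, triple_self_left, triple_self_right] at h1
    simpa [(A.head_side a).ne] using h1
  · have h1 : triple (A.T (A.g a)) (A.H (A.g a)) (s • A.T a + t • A.H a) = 0 := by
      rw [h]; simp [triple_apply]
    rw [triple_lin, hT, triple_lin, triple_self_left, triple_self_right] at h1
    simpa [(A.tail_side a).ne] using h1

theorem coeff_eq (a : ι) {s t s' t' : ℝ}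
    (h : s • A.T a + t • A.H a = s' • A.T a + t' • A.H a) : s = s' ∧ t = t' := by
  have h1 : (s - s') • A.T a + (t - t') • A.H a = 0 := by
    rw [sub_smul, sub_smul, ← sub_eq_zero.2 h]; abel
  have := A.indep a h1
  constructor <;> linarith

theorem f_ne_self (a : ι) : A.f a ≠ a := fun h => by
  have h1 := A.head_side a
  rw [h, triple_self_left] at h1
  exact h1.false

/-- Otherwise `H (f a)` would be a positive combination of `T a`, strictly to the right of `f a`,
and `H a`, in the plane of `f a`; it would lie off the plane of its own arc. -/
theorem f_f_ne_self (a : ι) : A.f (A.f a) ≠ a := fun h => by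
  obtain ⟨s, t, hs, ht, h1⟩ := A.head_mem a
  obtain ⟨s', t', hs', ht', h2⟩ := A.head_mem (A.f a)
  rw [h] at h2
  have h3 : triple (A.T (A.f a)) (A.H (A.f a)) (A.H (A.f a)) = 0 := triple_self_right _ _
  have h4 : triple (A.T (A.f a)) (A.H (A.f a)) (A.H a) = 0 := by
    rw [h1, triple_lin, triple_self_left, triple_self_right]; simp
  rw [h2, triple_lin, ← h2, h4] at h3
  have := A.head_side a
  nlinarith

/-- The tail of the arc into which `b` feeds with its head is on the left of `b`. -/
theorem tail_left (b : ι) : 0 < triple (A.T b) (A.H b) (A.T (A.f b)) := by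
  obtain ⟨s, t, hs, ht, h⟩ := A.head_mem b
  have h1 : triple (A.T b) (A.H b) (A.T (A.f b)) =
      -t * triple (A.T (A.f b)) (A.H (A.f b)) (A.T b) := by
    rw [h]; simp only [triple_apply, PiLp.add_apply, PiLp.smul_apply, smul_eq_mul]; ring
  have := A.head_side b
  rw [h1]; nlinarith

theorem g_f_ne (b : ι) : A.g (A.f b) ≠ b := fun h => by
  obtain ⟨s, t, hs, ht, h1⟩ := A.tail_mem (A.f b)
  have h2 := A.tail_left b
  rw [h1, triple_lin, h, triple_self_left, triple_self_right] at h2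
  simp at h2

/-- Otherwise `g (f b)` would start on `b` and run to its right, so the tail of `f b`, which it
contains, would be on the right of `b`, against `tail_left`. -/
theorem g_g_f_ne (b : ι) : A.g (A.g (A.f b)) ≠ b := fun h => by
  obtain ⟨s, t, hs, ht, h1⟩ := A.tail_mem (A.f b)
  obtain ⟨s', t', hs', ht', h2⟩ := A.tail_mem (A.g (A.f b))
  have h3 := A.tail_left b
  have h4 := A.tail_side (A.g (A.f b))
  rw [h] at h2 h4
  rw [h1, triple_lin, h2, triple_lin, triple_self_left, triple_self_right] at h3
  nlinarith

theorem g_ne_f (b : ι) : A.g b ≠ A.f b := fun h => by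
  obtain ⟨s, t, hs, ht, h1⟩ := A.tail_mem b
  have h2 := A.head_side b
  rw [← h, h1, triple_lin, triple_self_left, triple_self_right] at h2
  simp at h2

/-! ### Traversing the arcs counterclockwise about a view point -/

section Monotone

variable (k : E3)

open Classical in
/-- The end of an arc that is reached when the arc is traversed counterclockwise about `k`. -/
noncomputable def fore (a : ι) : E3 := if 0 < triple (A.T a) (A.H a) k then A.H a else A.T a

open Classical in
/-- The end of an arc at which a counterclockwise traversal about `k` starts. -/
noncomputable def back (a : ι) : E3 := if 0 < triple (A.T a) (A.H a) k then A.T a else A.H a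

open Classical in
/-- The arc that contains the fore end of a given arc. -/
noncomputable def next (a : ι) : ι := if 0 < triple (A.T a) (A.H a) k then A.f a else A.g a

theorem exists_back_fore (a : ι) (s t : ℝ) :
    ∃ s' t' : ℝ, s • A.T a + t • A.H a = s' • A.back k a + t' • A.fore k a ∧
      ((s' = s ∧ t' = t) ∨ (s' = t ∧ t' = s)) := by
  unfold back fore
  split_ifs
  · exact ⟨s, t, rfl, Or.inl ⟨rfl, rfl⟩⟩
  · exact ⟨t, s, add_comm _ _, Or.inr ⟨rfl, rfl⟩⟩

theorem exists_tail_head (a : ι) (s t : ℝ) :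
    ∃ s' t' : ℝ, s • A.back k a + t • A.fore k a = s' • A.T a + t' • A.H a ∧
      ((s' = s ∧ t' = t) ∨ (s' = t ∧ t' = s)) := by
  unfold back fore
  split_ifs
  · exact ⟨s, t, rfl, Or.inl ⟨rfl, rfl⟩⟩
  · exact ⟨t, s, add_comm _ _, Or.inr ⟨rfl, rfl⟩⟩

theorem fore_mem (a : ι) : ∃ s t : ℝ, 0 < s ∧ 0 < t ∧
    A.fore k a = s • A.back k (A.next k a) + t • A.fore k (A.next k a) := by
  have h : ∃ s t : ℝ, 0 < s ∧ 0 < t ∧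
      A.fore k a = s • A.T (A.next k a) + t • A.H (A.next k a) := by
    unfold fore next
    split_ifs
    · exact A.head_mem a
    · exact A.tail_mem a
  obtain ⟨s, t, hs, ht, h⟩ := h
  obtain ⟨s', t', h', hh⟩ := A.exists_back_fore k (A.next k a) s t
  refine ⟨s', t', ?_, ?_, h.trans h'⟩ <;> rcases hh with ⟨h1, h2⟩ | ⟨h1, h2⟩ <;> simp [*]

theorem back_side (a : ι) :
    triple (A.T (A.next k a)) (A.H (A.next k a)) (A.back k a) < 0 := by
  unfold back next
  split_ifs
  · exact A.head_side a
  · exact A.tail_side a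

variable {k} (hk : ∀ a, triple (A.T a) (A.H a) k ≠ 0)
include hk

theorem back_fore_pos (a : ι) : 0 < triple (A.back k a) (A.fore k a) k := by
  unfold back fore
  split_ifs with h
  · exact h
  · rw [triple_swap]
    exact neg_pos.2 (lt_of_le_of_ne (not_lt.1 h) (hk a))

/-- The paths advance counterclockwise at every step, because the fore end of `a` lies strictly
before the fore end of the arc that contains it. -/
theorem fore_fore_pos (a : ι) : 0 < triple (A.fore k a) (A.fore k (A.next k a)) k := by
  obtain ⟨s, t, hs, ht, h⟩ := A.fore_mem k a
  have h1 := A.back_fore_pos hk (A.next k a)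
  have h2 : triple (A.fore k (A.next k a)) (A.fore k (A.next k a)) k = 0 := by
    simp only [triple_apply]; ring
  rw [h, triple_lin_left, h2]
  nlinarith

end Monotone

end ArcSystem

/-! ### The region behind the closed paths, and walks that stay in it -/

theorem eventually_add_mul_nonneg {A B : ℝ} (hA : 0 ≤ A) (h : A = 0 → 0 ≤ B) :
    ∀ᶠ δ in 𝓝[>] (0 : ℝ), 0 ≤ A + δ * B := by
  rcases hA.eq_or_lt with h0 | h0
  · filter_upwards [self_mem_nhdsWithin] with δ hδ
    rw [← h0, zero_add]
    exact mul_nonneg (le_of_lt hδ) (h h0.symm)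
  · have : Tendsto (fun δ : ℝ => A + δ * B) (𝓝[>] 0) (𝓝 (A + 0 * B)) :=
      (Continuous.tendsto (by fun_prop) 0).mono_left nhdsWithin_le_nhds
    rw [zero_mul, add_zero] at this
    exact (this.eventually_const_lt h0).mono fun _ h => h.le

theorem triple_add_smul (x y z w : E3) (δ : ℝ) :
    triple x y (z + δ • w) = triple x y z + δ * triple x y w := by
  simpa using triple_lin x y z w 1 δ

namespace ArcSystem

variable {ι : Type*} (A : ArcSystem ι) (k : E3)

/-- The part of the path from `fore b` to `fore (next b)`, together with all that is behind it when
looking from `k`. -/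
def Shadow (b : ι) : Set E3 :=
  {x | 0 ≤ triple k (A.fore k b) x ∧ 0 ≤ triple k x (A.fore k (A.next k b)) ∧
    triple (A.fore k b) (A.fore k (A.next k b)) x ≤ 0}

/-- What lies on or behind the closed paths that run counterclockwise about `k`. -/
def Below : Set E3 := ⋃ b ∈ Function.periodicPts (A.next k), A.Shadow k b

theorem smul_mem_below {x : E3} (hx : x ∈ A.Below k) {r : ℝ} (hr : 0 ≤ r) :
    r • x ∈ A.Below k := by
  obtain ⟨b, hb, h1, h2, h3⟩ := Set.mem_iUnion₂.1 hx
  have e1 (u v : E3) : triple u v (r • x) = r * triple u v x := by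
    simpa using triple_lin u v x 0 r 0
  have e2 (u v : E3) : triple u (r • x) v = r * triple u x v := by
    simpa using triple_lin_mid u v x 0 r 0
  refine Set.mem_iUnion₂.2 ⟨b, hb, ?_, ?_, ?_⟩
  · rw [e1]; positivity
  · rw [e2]; positivity
  · rw [e1]; exact mul_nonpos_of_nonneg_of_nonpos hr h3

theorem isClosed_below [Finite ι] : IsClosed (A.Below k) := by
  refine (Set.toFinite _).isClosed_biUnion fun b _ => ?_
  have h : Continuous fun x => triple k x (A.fore k (A.next k b)) := by
    simp only [triple_apply]; fun_prop
  exact (isClosed_le continuous_const (continuous_triple _ _)).inter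
    ((isClosed_le continuous_const h).inter (isClosed_le (continuous_triple _ _) continuous_const))

theorem next_mem_periodicPts {b : ι} (hb : b ∈ Function.periodicPts (A.next k)) :
    A.next k b ∈ Function.periodicPts (A.next k) :=
  (Function.bijOn_periodicPts (A.next k)).mapsTo hb

theorem exists_next_eq {b : ι} (hb : b ∈ Function.periodicPts (A.next k)) :
    ∃ a ∈ Function.periodicPts (A.next k), A.next k a = b :=
  (Function.bijOn_periodicPts (A.next k)).surjOn hb

variable {k}

/-- The path from `fore b` to `fore (next b)`, its last point excluded, runs inside the relative
interior of `next b`; no other arc has interior points there. -/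
theorem eq_next_of_mem {e b : ι} {s t p q : ℝ} (hs : 0 < s) (ht : 0 < t) (hp : 0 < p) (hq : 0 ≤ q)
    (h : s • A.T e + t • A.H e = p • A.fore k b + q • A.fore k (A.next k b)) :
    e = A.next k b := by
  obtain ⟨u, v, hu, hv, h1⟩ := A.fore_mem k b
  obtain ⟨s', t', h2, h3⟩ := A.exists_tail_head k (A.next k b) (p * u) (p * v + q)
  have h4 : 0 < p * u := by positivity
  have h5 : 0 < p * v + q := by positivity
  refine A.disjoint e _ s t s' t' hs ht ?_ ?_ (by rw [h, ← h2, h1]; module) <;>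
    rcases h3 with ⟨rfl, rfl⟩ | ⟨rfl, rfl⟩ <;> assumption

variable (hk : ∀ a, triple (A.T a) (A.H a) k ≠ 0)
include hk

/-- Together with `mem_shadow_of_fore_next`: consecutive shadows share the face spanned by the
common fore end and `-k`. The second conjunct says how far a point of it is from the opposite face.
-/
theorem mem_shadow_of_fore {b : ι} {α β : ℝ} (hα : 0 ≤ α) (hβ : β ≤ 0) :
    α • A.fore k b + β • k ∈ A.Shadow k b ∧
    triple k (α • A.fore k b + β • k) (A.fore k (A.next k b)) =
      α * triple (A.fore k b) (A.fore k (A.next k b)) k := by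
  have hD := A.fore_fore_pos hk b
  set X := A.fore k b
  set Y := A.fore k (A.next k b)
  have e1 : triple k X (α • X + β • k) = 0 := by
    rw [triple_lin, triple_self_left, triple_self_right]; simp
  have e2 : triple k (α • X + β • k) Y = α * triple X Y k := by
    simp only [triple_apply, PiLp.add_apply, PiLp.smul_apply, smul_eq_mul]; ring
  have e3 : triple X Y (α • X + β • k) = β * triple X Y k := by
    rw [triple_lin, triple_self_left]; simp
  exact ⟨⟨e1.ge, e2.symm ▸ by positivity, e3.symm ▸ mul_nonpos_of_nonpos_of_nonneg hβ hD.le⟩, e2⟩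

theorem mem_shadow_of_fore_next {b : ι} {α β : ℝ} (hα : 0 ≤ α) (hβ : β ≤ 0) :
    α • A.fore k (A.next k b) + β • k ∈ A.Shadow k b ∧
    triple k (A.fore k b) (α • A.fore k (A.next k b) + β • k) =
      α * triple (A.fore k b) (A.fore k (A.next k b)) k := by
  have hD := A.fore_fore_pos hk b
  set X := A.fore k b
  set Y := A.fore k (A.next k b)
  have e1 : triple k X (α • Y + β • k) = α * triple X Y k := by
    simp only [triple_apply, PiLp.add_apply, PiLp.smul_apply, smul_eq_mul]; ring
  have e2 : triple k (α • Y + β • k) Y = 0 := by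
    simp only [triple_apply, PiLp.add_apply, PiLp.smul_apply, smul_eq_mul]; ring
  have e3 : triple X Y (α • Y + β • k) = β * triple X Y k := by
    rw [triple_lin, triple_self_right]; simp
  exact ⟨⟨e1.symm ▸ by positivity, e2.ge, e3.symm ▸ mul_nonpos_of_nonpos_of_nonneg hβ hD.le⟩, e1⟩

/-- By Cramer's rule, a shadow is the cone spanned by its two fore ends and `-k`; each inequality in
its definition is the sign of one coordinate. -/
theorem shadow_decomp {b : ι} {z : E3} (hz : z ∈ A.Shadow k b) :
    ∃ p q r : ℝ, 0 ≤ p ∧ 0 ≤ q ∧ r ≤ 0 ∧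
      z = p • A.fore k b + q • A.fore k (A.next k b) + r • k ∧
      triple k z (A.fore k (A.next k b)) =
        p * triple (A.fore k b) (A.fore k (A.next k b)) k ∧
      triple k (A.fore k b) z = q * triple (A.fore k b) (A.fore k (A.next k b)) k ∧
      triple (A.fore k b) (A.fore k (A.next k b)) z =
        r * triple (A.fore k b) (A.fore k (A.next k b)) k := by
  have hD := A.fore_fore_pos hk b
  obtain ⟨h1, h2, h3⟩ := hz
  set X := A.fore k b
  set Y := A.fore k (A.next k b)
  refine ⟨triple k z Y / triple X Y k, triple k X z / triple X Y k, triple X Y z / triple X Y k,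
    by positivity, by positivity, div_nonpos_of_nonpos_of_nonneg h3 hD.le, ?_,
    by field_simp, by field_simp, by field_simp⟩
  have h := triple_cramer X Y k z
  rw [show triple z Y k = triple k z Y from (triple_cycle _ _ _).symm,
    show triple X z k = triple k X z from (triple_cycle _ _ _).symm] at h
  have h4 : z = (triple X Y k)⁻¹ • (triple X Y k • z) := by
    rw [smul_smul, inv_mul_cancel₀ hD.ne', one_smul]
  rw [h] at h4
  conv_lhs => rw [h4]
  module

/-- The local step: a point of an arc behind the paths stays behind them when it is moved slightly
towards the head of the arc. -/
theorem eventually_mem_below {e : ι} {z w : E3} {σ τ α β : ℝ} (hσ : 0 < σ) (hτ : 0 < τ)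
    (hz : z = σ • A.T e + τ • A.H e) (hw : w = α • A.T e + β • A.H e)
    (hdir : 0 < σ * β - τ * α) (hzB : z ∈ A.Below k) :
    ∀ᶠ δ in 𝓝[>] (0 : ℝ), z + δ • w ∈ A.Below k := by
  -- The sign of this product tells whether the motion turns clockwise or counterclockwise about
  -- `k`.
  have key : triple k z w = (σ * β - τ * α) * triple (A.T e) (A.H e) k := by
    rw [hz, hw]; simp only [triple_apply, PiLp.add_apply, PiLp.smul_apply, smul_eq_mul]; ring
  have ne0 : triple k z w ≠ 0 := by rw [key]; exact mul_ne_zero hdir.ne' (hk e)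
  have zk (r : ℝ) : z ≠ r • k := fun h => ne0 (by
    rw [h]; simp only [triple_apply, PiLp.smul_apply, smul_eq_mul]; ring)
  obtain ⟨b, hb, hS⟩ := Set.mem_iUnion₂.1 hzB
  -- it suffices to find a shadow for which the three inequalities persist
  have suff : ∀ b ∈ Function.periodicPts (A.next k), z ∈ A.Shadow k b →
      (triple k (A.fore k b) z = 0 → 0 ≤ triple k (A.fore k b) w) →
      (triple k z (A.fore k (A.next k b)) = 0 → 0 ≤ triple k w (A.fore k (A.next k b))) →
      (triple (A.fore k b) (A.fore k (A.next k b)) z = 0 →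
        triple (A.fore k b) (A.fore k (A.next k b)) w ≤ 0) →
      ∀ᶠ δ in 𝓝[>] (0 : ℝ), z + δ • w ∈ A.Below k := by
    intro b hb ⟨s1, s2, s3⟩ h1 h2 h3
    filter_upwards [eventually_add_mul_nonneg s1 h1, eventually_add_mul_nonneg s2 h2,
      eventually_add_mul_nonneg (neg_nonneg.2 s3) fun h => neg_nonneg.2 (h3 (neg_eq_zero.1 h))]
      with δ d1 d2 d3
    refine Set.mem_iUnion₂.2 ⟨b, hb, ?_, ?_, ?_⟩
    · rwa [triple_add_smul]
    · have : triple k (z + δ • w) (A.fore k (A.next k b)) =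
          triple k z (A.fore k (A.next k b)) + δ * triple k w (A.fore k (A.next k b)) := by
        simpa using triple_lin_mid k (A.fore k (A.next k b)) z w 1 δ
      rwa [this]
    · rw [triple_add_smul]; linarith
  -- if the arc carries the path, then it stays in its plane
  have coplanar : ∀ b, e = A.next k b →
      triple (A.fore k b) (A.fore k (A.next k b)) w = 0 := by
    rintro b rfl
    obtain ⟨u, v, -, -, h1⟩ := A.fore_mem k b
    obtain ⟨s', t', h2, -⟩ := A.exists_back_fore k (A.next k b) α β
    rw [hw, h2, h1]
    simp only [triple_apply, PiLp.add_apply, PiLp.smul_apply, smul_eq_mul]; ring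
  rcases lt_or_gt_of_ne ne0 with hneg | hpos
  -- Clockwise motion needs a shadow with room on the clockwise side; if `z` is on that face, the
  -- preceding shadow serves.
  · obtain ⟨b, hb, hS, hlt⟩ : ∃ b ∈ Function.periodicPts (A.next k), z ∈ A.Shadow k b ∧
        0 < triple k (A.fore k b) z := by
      rcases hS.1.eq_or_lt with h0 | h0
      · obtain ⟨a, ha, rfl⟩ := A.exists_next_eq k hb
        obtain ⟨p, q, r, hp, hq, hr, hz', -, e2, -⟩ := A.shadow_decomp hk hS
        have hq0 : q = 0 := by
          rw [← h0] at e2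
          simpa [(A.fore_fore_pos hk (A.next k a)).ne'] using e2.symm
        rw [hq0, zero_smul, add_zero] at hz'
        have hp' : 0 < p := lt_of_le_of_ne hp fun h => zk r (by rw [hz', ← h]; module)
        have := A.mem_shadow_of_fore_next hk (b := a) hp hr
        rw [← hz'] at this
        exact ⟨a, ha, this.1, this.2 ▸ mul_pos hp' (A.fore_fore_pos hk a)⟩
      · exact ⟨b, hb, hS, h0⟩
    obtain ⟨p, q, r, hp, hq, hr, hz', e1, e2, e3⟩ := A.shadow_decomp hk hS
    have hD := A.fore_fore_pos hk b
    have hq' : 0 < q := pos_of_mul_pos_left (e2 ▸ hlt) hD.le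
    refine suff b hb hS (fun h => absurd h hlt.ne') (fun h => ?_) (fun h => ?_)
    · have hp0 : p = 0 := by
        rw [h] at e1
        simpa [hD.ne'] using e1.symm
      have h4 : triple k z w = -q * triple k w (A.fore k (A.next k b)) := by
        rw [hz', hp0]
        simp only [triple_apply, PiLp.add_apply, PiLp.smul_apply, smul_eq_mul]; ring
      rw [h4] at hneg
      nlinarith
    · have hr0 : r = 0 := by
        rw [h] at e3
        simpa [hD.ne'] using e3.symm
      rw [hr0, zero_smul, add_zero] at hz'
      rcases hp.eq_or_lt with hp0 | hp'
      · rw [← hp0, zero_smul, zero_add] at hz'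
        -- Here `z` is the vertex at which `next b` runs into `e`. Since `next b` arrives from the
        -- right of `e`, moving towards the head of `e` leaves the plane of `next b` on the side
        -- away from `k`.
        have he : e = A.next k (A.next k b) :=
          A.eq_next_of_mem (k := k) (q := 0) hσ hτ hq' le_rfl (by rw [← hz, hz']; module)
        have hs := A.back_side k (A.next k b)
        rw [← he] at hs
        obtain ⟨u, v, hu, hv, h1⟩ := A.fore_mem k b
        have h5 : q * triple (A.fore k b) (A.fore k (A.next k b)) w =
            u * ((σ * β - τ * α) * triple (A.T e) (A.H e) (A.back k (A.next k b))) := by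
          have h6 : q * triple (A.fore k b) (A.fore k (A.next k b)) w =
              u * triple z w (A.back k (A.next k b)) := by
            rw [h1, hz']
            simp only [triple_apply, PiLp.add_apply, PiLp.smul_apply, smul_eq_mul]; ring
          rw [h6, hz, hw]
          simp only [triple_apply, PiLp.add_apply, PiLp.smul_apply, smul_eq_mul]; ring
        have h7 : u * ((σ * β - τ * α) * triple (A.T e) (A.H e) (A.back k (A.next k b))) < 0 :=
          mul_neg_of_pos_of_neg hu (mul_neg_of_pos_of_neg hdir hs)
        by_contra h8
        push Not at h8
        nlinarith
      · exact (coplanar b (A.eq_next_of_mem hσ hτ hp' hq (hz ▸ hz'))).le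
  -- Counterclockwise motion is alike with the following shadow. Now `z` is not the last point of
  -- the path piece, so if `z` is on the path, `e` carries it.
  · obtain ⟨b, hb, hS, hlt⟩ : ∃ b ∈ Function.periodicPts (A.next k), z ∈ A.Shadow k b ∧
        0 < triple k z (A.fore k (A.next k b)) := by
      rcases hS.2.1.eq_or_lt with h0 | h0
      · obtain ⟨p, q, r, hp, hq, hr, hz', e1, -, -⟩ := A.shadow_decomp hk hS
        have hp0 : p = 0 := by
          rw [← h0] at e1
          simpa [(A.fore_fore_pos hk b).ne'] using e1.symm
        rw [hp0, zero_smul, zero_add] at hz'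
        have hq' : 0 < q := lt_of_le_of_ne hq fun h => zk r (by rw [hz', ← h]; module)
        have := A.mem_shadow_of_fore hk (b := A.next k b) hq hr
        rw [← hz'] at this
        exact ⟨_, A.next_mem_periodicPts k hb, this.1,
          this.2 ▸ mul_pos hq' (A.fore_fore_pos hk _)⟩
      · exact ⟨b, hb, hS, h0⟩
    obtain ⟨p, q, r, hp, hq, hr, hz', e1, e2, e3⟩ := A.shadow_decomp hk hS
    have hD := A.fore_fore_pos hk b
    have hp' : 0 < p := pos_of_mul_pos_left (e1 ▸ hlt) hD.le
    refine suff b hb hS (fun h => ?_) (fun h => absurd h hlt.ne') (fun h => ?_)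
    · have hq0 : q = 0 := by
        rw [h] at e2
        simpa [hD.ne'] using e2.symm
      have h4 : triple k z w = p * triple k (A.fore k b) w := by
        rw [hz', hq0]
        simp only [triple_apply, PiLp.add_apply, PiLp.smul_apply, smul_eq_mul]; ring
      rw [h4] at hpos
      exact (pos_of_mul_pos_right hpos hp).le
    · have hr0 : r = 0 := by
        rw [h] at e3
        simpa [hD.ne'] using e3.symm
      rw [hr0, zero_smul, add_zero] at hz'
      exact (coplanar b (A.eq_next_of_mem hσ hτ hp' hq (hz ▸ hz'))).le

/-- A point of an arc behind the paths stays behind them all the way to the head of the arc. -/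
theorem segment_mem_below [Finite ι] {e : ι} {σ τ : ℝ} (hσ : 0 < σ) (hτ : 0 < τ)
    (hx : σ • A.T e + τ • A.H e ∈ A.Below k) {t : ℝ} (ht : t ∈ Set.Icc (0 : ℝ) 1) :
    (1 - t) • (σ • A.T e + τ • A.H e) + t • A.H e ∈ A.Below k := by
  let y : ℝ → E3 := fun t => (1 - t) • (σ • A.T e + τ • A.H e) + t • A.H e
  have hy : Continuous y := by fun_prop
  suffices Set.Icc (0 : ℝ) 1 ⊆ y ⁻¹' A.Below k from this ht
  -- Continuous induction: the region is closed, and the local step advances past any point before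
  -- the head. The velocity is the head minus the starting point.
  refine (((A.isClosed_below k).preimage hy).inter isClosed_Icc).Icc_subset_of_forall_exists_gt
    (by simpa [y] using hx) ?_
  rintro t ⟨htB, ht0, ht1⟩ v hv
  have hpos : 0 < 1 - t := by linarith
  have hev := A.eventually_mem_below hk (e := e) (z := y t) (σ := (1 - t) * σ)
    (τ := (1 - t) * τ + t) (w := -σ • A.T e + (1 - τ) • A.H e) (α := -σ) (β := 1 - τ)
    (by positivity) (by positivity) (by simp only [y]; module) rfl (by nlinarith) htB
  have hlt : ∀ᶠ δ in 𝓝[>] (0 : ℝ), δ < v - t :=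
    nhdsWithin_le_nhds (Iio_mem_nhds (sub_pos.2 hv))
  obtain ⟨δ, ⟨h1, h2⟩, h3⟩ := ((hev.and hlt).and self_mem_nhdsWithin).exists
  have h3' : 0 < δ := h3
  refine ⟨t + δ, ?_, ?_, ?_⟩
  · have : y (t + δ) = y t + δ • (-σ • A.T e + (1 - τ) • A.H e) := by simp only [y]; module
    rw [Set.mem_preimage, this]
    exact h1
  · linarith
  · linarith

end ArcSystem

/-! ### Walks that avoid a given arc -/

theorem exists_iterate_mem_periodicPts {α : Type*} [Finite α] (f : α → α) (x : α) :
    ∃ i, f^[i] x ∈ Function.periodicPts f := by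
  obtain ⟨i, j, hne, hij⟩ := Finite.exists_ne_map_eq_of_infinite fun i => f^[i] x
  wlog hlt : i < j generalizing i j
  · exact this j i hne.symm hij.symm (by omega)
  refine ⟨i, Function.mk_mem_periodicPts (n := j - i) (by omega) ?_⟩
  rw [Function.IsPeriodicPt, Function.IsFixedPt, ← Function.iterate_add_apply,
    Nat.sub_add_cancel hlt.le]
  exact hij.symm

namespace ArcSystem

variable {ι : Type*} (A : ArcSystem ι)

/-- A view point just to the right of `c`, near a point of `c` close to the head of `c`. -/
theorem exists_view_point [Finite ι] (c : ι) : ∃ (t : ℝ) (k : E3), 0 < t ∧ t < 1 ∧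
    (∀ a, ∀ s u : ℝ, 0 < s → 0 < u → (A.T a = s • A.T c + u • A.H c ∨
      A.H a = s • A.T c + u • A.H c) → t * u < (1 - t) * s) ∧
    (∀ a, triple (A.T a) (A.H a) k ≠ 0) ∧
    (∀ a, triple (A.T a) (A.H a) (t • A.T c + (1 - t) • A.H c) = 0 ∨
      0 < triple (A.T a) (A.H a) (t • A.T c + (1 - t) • A.H c) * triple (A.T a) (A.H a) k) ∧
    triple (A.T c) (A.H c) k < 0 := by
  -- The inequality says that `z` is nearer to the head of `c` than `p` is; it holds for small `t`.
  have ends (p : E3) : ∀ᶠ t in 𝓝[>] (0 : ℝ), ∀ s u : ℝ, 0 < s → 0 < u →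
      p = s • A.T c + u • A.H c → t * u < (1 - t) * s := by
    by_cases h : ∃ s u : ℝ, 0 < s ∧ 0 < u ∧ p = s • A.T c + u • A.H c
    · obtain ⟨s, u, hs, hu, rfl⟩ := h
      have h1 : Tendsto (fun t : ℝ => (1 - t) * s - t * u) (𝓝[>] 0)
          (𝓝 ((1 - 0) * s - 0 * u)) :=
        (Continuous.tendsto (by fun_prop) 0).mono_left nhdsWithin_le_nhds
      filter_upwards [h1.eventually_const_lt (u := 0) (by linarith)] with t ht s' u' _ _ h2
      obtain ⟨rfl, rfl⟩ := A.coeff_eq c h2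
      linarith
    · exact Eventually.of_forall fun t s u hs hu hp => absurd ⟨s, u, hs, hu, hp⟩ h
  -- For small `t > 0`, `z` avoids every plane of an arc that does not contain all of `c`.
  have gen (a : ι) : ∀ᶠ t in 𝓝[>] (0 : ℝ),
      triple (A.T a) (A.H a) (t • A.T c + (1 - t) • A.H c) ≠ 0 ∨
        (triple (A.T a) (A.H a) (A.T c) = 0 ∧ triple (A.T a) (A.H a) (A.H c) = 0) := by
    simp only [triple_lin]
    by_cases hB : triple (A.T a) (A.H a) (A.H c) = 0
    · by_cases hC : triple (A.T a) (A.H a) (A.T c) = 0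
      · exact Eventually.of_forall fun t => Or.inr ⟨hC, hB⟩
      · filter_upwards [self_mem_nhdsWithin] with t ht
        left
        rw [hB, mul_zero, add_zero]
        exact mul_ne_zero (ne_of_gt ht) hC
    · have h1 : Tendsto (fun t : ℝ => t * triple (A.T a) (A.H a) (A.T c) +
          (1 - t) * triple (A.T a) (A.H a) (A.H c)) (𝓝[>] 0)
          (𝓝 (0 * triple (A.T a) (A.H a) (A.T c) +
          (1 - 0) * triple (A.T a) (A.H a) (A.H c))) :=
        (Continuous.tendsto (by fun_prop) 0).mono_left nhdsWithin_le_nhds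
      filter_upwards [h1.eventually_ne (by simpa using hB)] with t ht
      exact Or.inl ht
  have lt1 : ∀ᶠ t in 𝓝[>] (0 : ℝ), t < 1 := nhdsWithin_le_nhds (Iio_mem_nhds one_pos)
  obtain ⟨t, ⟨⟨⟨htT, htH⟩, htg⟩, ht1⟩, ht0⟩ :=
    (((((eventually_all.2 fun a => ends (A.T a)).and (eventually_all.2 fun a => ends (A.H a))).and
      (eventually_all.2 gen)).and lt1).and self_mem_nhdsWithin).exists
  set z := t • A.T c + (1 - t) • A.H c with hz
  set n := -A.T (A.f c) with hn
  have hcn : triple (A.T c) (A.H c) n < 0 := by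
    have := A.tail_left c
    rw [hn]
    simp only [triple_apply, PiLp.neg_apply] at this ⊢
    linarith
  have hcz : triple (A.T c) (A.H c) z = 0 := by
    rw [hz, triple_lin, triple_self_left, triple_self_right]; simp
  have nz (a : ι) (h1 : triple (A.T a) (A.H a) (A.T c) = 0)
      -- If `n` were also in the plane of `a`, then that plane would contain the basis `T c`, `H c`,
      -- `n`, hence everything, against `tail_left`.
      (h2 : triple (A.T a) (A.H a) (A.H c) = 0) : triple (A.T a) (A.H a) n ≠ 0 := fun h3 => by
    have h4 := congrArg (triple (A.T a) (A.H a)) (triple_cramer (A.T c) (A.H c) n (A.T (A.f a)))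
    have h5 (r : ℝ) (x : E3) :
        triple (A.T a) (A.H a) (r • x) = r * triple (A.T a) (A.H a) x := by
      simpa using triple_lin (A.T a) (A.H a) x 0 r 0
    have h6 (x y : E3) : triple (A.T a) (A.H a) (x + y) =
        triple (A.T a) (A.H a) x + triple (A.T a) (A.H a) y := by
      simpa using triple_lin (A.T a) (A.H a) x y 1 1
    rw [h6, h6, h5, h5, h5, h5, h1, h2, h3] at h4
    have := mul_ne_zero hcn.ne (A.tail_left a).ne'
    simp_all
  have side (a : ι) : ∀ᶠ ε in 𝓝[>] (0 : ℝ), triple (A.T a) (A.H a) (z + ε • n) ≠ 0 ∧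
      (triple (A.T a) (A.H a) z = 0 ∨
        0 < triple (A.T a) (A.H a) z * triple (A.T a) (A.H a) (z + ε • n)) := by
    simp only [triple_add_smul]
    by_cases h0 : triple (A.T a) (A.H a) z = 0
    · have h1 := (htg a).resolve_left (not_not.2 h0)
      filter_upwards [self_mem_nhdsWithin] with ε hε
      rw [h0, zero_add]
      exact ⟨mul_ne_zero (ne_of_gt hε) (nz a h1.1 h1.2), Or.inl rfl⟩
    · have h1 : Tendsto (fun ε : ℝ => triple (A.T a) (A.H a) z *
          (triple (A.T a) (A.H a) z + ε * triple (A.T a) (A.H a) n)) (𝓝[>] 0)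
          (𝓝 (triple (A.T a) (A.H a) z *
          (triple (A.T a) (A.H a) z + 0 * triple (A.T a) (A.H a) n))) :=
        (Continuous.tendsto (by fun_prop) 0).mono_left nhdsWithin_le_nhds
      filter_upwards [h1.eventually_const_lt (u := 0)
        (by rw [zero_mul, add_zero]; exact mul_self_pos.2 h0)] with ε hε
      exact ⟨fun h => by simp [h] at hε, Or.inr hε⟩
  obtain ⟨ε, hε, hε0⟩ := ((eventually_all.2 side).and self_mem_nhdsWithin).exists
  refine ⟨t, z + ε • n, ht0, ht1, ?_, fun a => (hε a).1, fun a => (hε a).2, ?_⟩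
  · rintro a s u hs hu (h | h)
    · exact htT a s u hs hu h
    · exact htH a s u hs hu h
  · rw [triple_add_smul, hcz, zero_add]
    exact mul_neg_of_pos_of_neg hε0 hcn

/-- No arc is met by all walks that always turn right. -/
theorem exists_iterate_ne [Finite ι] (c : ι) : ∃ b, ∀ i, A.f^[i] b ≠ c := by
  obtain ⟨t, k, ht0, ht1, hends, hk, hz, hck⟩ := A.exists_view_point c
  obtain ⟨i₀, hb₀⟩ := exists_iterate_mem_periodicPts (A.next k) c
  set b₀ := (A.next k)^[i₀] c
  -- The fore end of `b₀` is on a closed path and inside `next b₀`, so the walk from `next b₀`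
  -- starts there.
  refine ⟨A.next k b₀, fun i hi => ?_⟩
  have fore_end (b : ι) : A.fore k b = A.T b ∨ A.fore k b = A.H b := by
    unfold fore; split_ifs <;> simp
  -- the walk stays behind the paths
  have walk (i : ℕ) : ∃ (x : E3) (s u : ℝ), (∃ a, A.T a = x ∨ A.H a = x) ∧ 0 < s ∧ 0 < u ∧
      x = s • A.T (A.f^[i] (A.next k b₀)) + u • A.H (A.f^[i] (A.next k b₀)) ∧
      x ∈ A.Below k := by
    induction i with
    | zero =>
      obtain ⟨s, u, hs, hu, h⟩ := A.fore_mem k b₀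
      obtain ⟨s', u', h', hh⟩ := A.exists_tail_head k (A.next k b₀) s u
      refine ⟨_, s', u', ⟨b₀, ?_⟩, ?_, ?_, h.trans h', ?_⟩
      · exact (fore_end b₀).imp Eq.symm Eq.symm
      · rcases hh with ⟨rfl, rfl⟩ | ⟨rfl, rfl⟩ <;> assumption
      · rcases hh with ⟨rfl, rfl⟩ | ⟨rfl, rfl⟩ <;> assumption
      · have := (A.mem_shadow_of_fore hk (b := b₀) zero_le_one le_rfl).1
        rw [one_smul, zero_smul, add_zero] at this
        exact Set.mem_iUnion₂.2 ⟨b₀, hb₀, this⟩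
    | succ i ih =>
      obtain ⟨x, s, u, -, hs, hu, rfl, hx⟩ := ih
      obtain ⟨s', u', hs', hu', h⟩ := A.head_mem (A.f^[i] (A.next k b₀))
      have h1 := A.segment_mem_below hk hs hu hx (t := 1) ⟨zero_le_one, le_rfl⟩
      rw [sub_self, zero_smul, zero_add, one_smul] at h1
      rw [Function.iterate_succ_apply']
      exact ⟨_, s', u', ⟨_, Or.inr rfl⟩, hs', hu', h, h1⟩
  obtain ⟨x, s, u, ⟨a, ha⟩, hs, hu, hx, hxB⟩ := walk i
  rw [hi] at hx
  -- The walk enters `c` at an endpoint of an arc, so `z` is still ahead.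
  have hlt := hends a s u hs hu (ha.imp (·.trans hx) (·.trans hx))
  have hzB : t • A.T c + (1 - t) • A.H c ∈ A.Below k := by
    rw [hx] at hxB
    have hA : 0 < s * (1 - t) - t * u := by linarith
    have h1 := A.segment_mem_below hk hs hu hxB
      -- This parameter makes the tail and head coefficients proportional to `t` and `1 - t`, so the
      -- point is a positive multiple of `z`.
      (t := (s * (1 - t) - t * u) / (s * (1 - t) - t * u + t))
      ⟨by positivity, by rw [div_le_one (by positivity)]; linarith⟩
    have h2 := A.smul_mem_below k h1 (r := (s * (1 - t) - t * u + t) / s) (by positivity)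
    convert h2 using 1
    set B := s * (1 - t) - t * u with hB
    have hBt : B + t ≠ 0 := by positivity
    rw [smul_add, smul_smul, smul_smul, smul_add, smul_smul, smul_smul, add_assoc, ← add_smul]
    congr 2
    · field_simp; ring
    · field_simp; rw [hB]; ring
  obtain ⟨b, hb, hS⟩ := Set.mem_iUnion₂.1 hzB
  obtain ⟨p, q, r, hp, hq, hr, hz', -, -, e3⟩ := A.shadow_decomp hk hS
  have hD := A.fore_fore_pos hk b
  obtain ⟨v, w, hv, hw, hfore⟩ := A.fore_mem k b
  -- If `r < 0`, the plane of `next b` would strictly separate `z` from `k`.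
  have hr0 : r = 0 := by
    by_contra hr0
    have hr' : r < 0 := lt_of_le_of_ne hr hr0
    have hneg : triple (A.back k (A.next k b)) (A.fore k (A.next k b))
        (t • A.T c + (1 - t) • A.H c) < 0 := by
      have h1 : triple (A.fore k b) (A.fore k (A.next k b)) (t • A.T c + (1 - t) • A.H c) =
          v * triple (A.back k (A.next k b)) (A.fore k (A.next k b))
            (t • A.T c + (1 - t) • A.H c) := by
        rw [hfore]
        simp only [triple_apply, PiLp.add_apply, PiLp.smul_apply, smul_eq_mul]; ring
      rw [h1] at e3
      have : r * triple (A.fore k b) (A.fore k (A.next k b)) k < 0 :=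
        mul_neg_of_neg_of_pos hr' hD
      by_contra h
      push Not at h
      nlinarith [mul_nonneg hv.le h]
    have hpos := A.back_fore_pos hk (A.next k b)
    have := hz (A.next k b)
    unfold back fore at hneg hpos
    split_ifs at hneg hpos
    · rcases this with h | h <;> nlinarith
    · rw [triple_swap] at hneg hpos
      rcases this with h | h <;> nlinarith
  rw [hr0, zero_smul, add_zero] at hz'
  have h1t : 0 < 1 - t := by linarith
  -- Either `z` is itself in the direction of an arc endpoint inside `c`, or the path runs along `c`
  -- towards its tail and joined it at an endpoint at least as near to the head as `z`. Both
  -- contradict the choice of `t`.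
  rcases hp.eq_or_lt with hp0 | hp'
  · rw [← hp0, zero_smul, zero_add] at hz'
    have hq' : 0 < q := lt_of_le_of_ne hq fun h => by
      rw [← h, zero_smul] at hz'
      exact ht0.ne' (A.indep c hz').1
    have hc : c = A.next k (A.next k b) :=
      A.eq_next_of_mem (k := k) (q := 0) ht0 h1t hq' le_rfl (by rw [hz']; module)
    obtain ⟨s', u', hs', hu', h⟩ := A.fore_mem k (A.next k b)
    rw [← hc] at h
    obtain ⟨s₁, u₁, h₁, hh⟩ := A.exists_tail_head k c s' u'
    rw [h₁] at h
    have hs₁ : 0 < s₁ ∧ 0 < u₁ := by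
      rcases hh with ⟨rfl, rfl⟩ | ⟨rfl, rfl⟩ <;> constructor <;> assumption
    have h2 := hends _ s₁ u₁ hs₁.1 hs₁.2 ((fore_end (A.next k b)).imp
      (fun e => e.symm.trans h) (fun e => e.symm.trans h))
    rw [h, smul_add, smul_smul, smul_smul] at hz'
    obtain ⟨e1, e2⟩ := A.coeff_eq c hz'
    rw [e2, e1] at h2
    nlinarith
  · have hc : c = A.next k b := A.eq_next_of_mem ht0 h1t hp' hq hz'
    rw [← hc] at hfore hz'
    have hback : A.back k c = A.H c := by unfold back; rw [if_neg hck.not_gt]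
    have hforec : A.fore k c = A.T c := by unfold fore; rw [if_neg hck.not_gt]
    rw [hback, hforec, add_comm] at hfore
    have h2 := hends _ w v hw hv ((fore_end b).imp
      (fun e => e.symm.trans hfore) (fun e => e.symm.trans hfore))
    rw [hfore, hforec] at hz'
    have h3 : t • A.T c + (1 - t) • A.H c = (p * w + q) • A.T c + (p * v) • A.H c := by
      rw [hz']; module
    obtain ⟨e1, e2⟩ := A.coeff_eq c h3
    rw [e2, e1] at h2
    nlinarith [mul_nonneg (mul_nonneg hq hp) hv.le, mul_pos hp' hv]

end ArcSystem

/-! ### Cycles of a self-map as finite sets -/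

section Orbit

variable {α : Type*} [DecidableEq α] (f : α → α)

/-- The points of the cycle of a periodic point. -/
noncomputable def orbitFinset (x : α) : Finset α :=
  (Finset.range (Function.minimalPeriod f x)).image fun i => f^[i] x

theorem card_orbitFinset (x : α) : (orbitFinset f x).card = Function.minimalPeriod f x := by
  rw [orbitFinset, Finset.card_image_of_injOn, Finset.card_range]
  intro i hi j hj h
  exact Function.iterate_injOn_Iio_minimalPeriod (by simpa using hi) (by simpa using hj) h

variable {f}

theorem mem_orbitFinset {x : α} (hx : x ∈ Function.periodicPts f) {y : α} :
    y ∈ orbitFinset f x ↔ ∃ i, f^[i] x = y := by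
  simp only [orbitFinset, Finset.mem_image, Finset.mem_range]
  constructor
  · rintro ⟨i, -, h⟩
    exact ⟨i, h⟩
  · rintro ⟨i, h⟩
    exact ⟨i % Function.minimalPeriod f x,
      Nat.mod_lt _ (Function.minimalPeriod_pos_of_mem_periodicPts hx),
      by rw [Function.iterate_mod_minimalPeriod_eq, h]⟩

theorem exists_iterate_of_mem_orbitFinset {x y z : α} (hx : x ∈ Function.periodicPts f)
    (hy : y ∈ orbitFinset f x) (hz : z ∈ orbitFinset f x) :
    ∃ i < Function.minimalPeriod f x, f^[i] y = z := by
  obtain ⟨i, rfl⟩ := (mem_orbitFinset hx).1 hy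
  obtain ⟨j, rfl⟩ := (mem_orbitFinset hx).1 hz
  have hpos := Function.minimalPeriod_pos_of_mem_periodicPts hx
  set m := Function.minimalPeriod f x with hm
  refine ⟨(j + (m - i % m)) % m, Nat.mod_lt _ hpos, ?_⟩
  rw [← Function.iterate_add_apply, ← Function.iterate_mod_minimalPeriod_eq (n := _ + i), ← hm,
    ← Function.iterate_mod_minimalPeriod_eq (n := j), ← hm]
  congr 1
  have := Nat.mod_lt i hpos
  have h1 : (j + (m - i % m)) % m + i ≡ j + (m - i % m) + i % m [MOD m] :=
    (Nat.mod_modEq _ _).add (Nat.mod_modEq _ _).symm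
  rw [add_assoc, Nat.sub_add_cancel this.le] at h1
  exact h1.trans (by simp [Nat.ModEq])

theorem iterate_minimalPeriod_of_mem {x y : α} (hx : x ∈ Function.periodicPts f)
    (hy : y ∈ orbitFinset f x) : f^[Function.minimalPeriod f x] y = y := by
  obtain ⟨i, rfl⟩ := (mem_orbitFinset hx).1 hy
  exact (Function.isPeriodicPt_minimalPeriod f x).apply_iterate i

end Orbit

/-! ### Counting arcs: the lower bound -/

namespace ArcSystem

variable {ι : Type*} (A : ArcSystem ι)

theorem three_le_minimalPeriod {x : ι} (hx : x ∈ Function.periodicPts A.f) :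
    3 ≤ Function.minimalPeriod A.f x := by
  have hpos := Function.minimalPeriod_pos_of_mem_periodicPts hx
  have h := Function.isPeriodicPt_minimalPeriod A.f x
  by_contra hlt
  have : Function.minimalPeriod A.f x = 1 ∨ Function.minimalPeriod A.f x = 2 := by omega
  rcases this with h1 | h1 <;> rw [h1] at h
  · exact A.f_ne_self x h
  · exact A.f_f_ne_self x h

/-- Start at an arc whose walk avoids a periodic arc `x`. The cycle in which it ends misses the
cycle of `x`, as otherwise the walk would go on to `x`. -/
theorem exists_two_cycles [Finite ι] [Nonempty ι] [DecidableEq ι] :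
    ∃ x ∈ Function.periodicPts A.f, ∃ y ∈ Function.periodicPts A.f,
      Disjoint (orbitFinset A.f x) (orbitFinset A.f y) := by
  obtain ⟨i, hi⟩ := exists_iterate_mem_periodicPts A.f (Classical.arbitrary ι)
  set x := A.f^[i] (Classical.arbitrary ι)
  obtain ⟨b, hb⟩ := A.exists_iterate_ne x
  obtain ⟨j, hj⟩ := exists_iterate_mem_periodicPts A.f b
  refine ⟨x, hi, _, hj, Finset.disjoint_left.2 fun z hz hz' => ?_⟩
  obtain ⟨m, -, hm⟩ := exists_iterate_of_mem_orbitFinset hi hz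
    ((mem_orbitFinset hi).2 ⟨0, rfl⟩)
  obtain ⟨l, rfl⟩ := (mem_orbitFinset hj).1 hz'
  rw [← Function.iterate_add_apply, ← Function.iterate_add_apply] at hm
  exact hb _ hm

/-- Two distinct arcs of a 3-cycle of `f` are always consecutive in one order or the other, and a
cycle of `g` of length at most 4 cannot contain both `b` and `f b`. -/
theorem card_inter_le_one [DecidableEq ι] {x y : ι} (hx : x ∈ Function.periodicPts A.f)
    (hy : y ∈ Function.periodicPts A.g) (hx3 : Function.minimalPeriod A.f x = 3)
    (hy4 : Function.minimalPeriod A.g y ≤ 4) :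
    (orbitFinset A.f x ∩ orbitFinset A.g y).card ≤ 1 := by
  have key (b : ι) (h1 : b ∈ orbitFinset A.g y) (h2 : A.f b ∈ orbitFinset A.g y) : False := by
    obtain ⟨i, hi, h⟩ := exists_iterate_of_mem_orbitFinset hy h2 h1
    have h3 : 3 ≤ Function.minimalPeriod A.g y := A.dual.three_le_minimalPeriod hy
    have h4 := iterate_minimalPeriod_of_mem hy h2
    have : i = 0 ∨ i = 1 ∨ i = 2 ∨ i = 3 := by omega
    rcases this with rfl | rfl | rfl | rfl
    · exact A.f_ne_self b h
    · exact A.g_f_ne b h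
    · exact A.g_g_f_ne b h
    -- Three steps from `f b` to `b` force length 4, so the fourth step gives `g b = f b`.
    · rw [show Function.minimalPeriod A.g y = 3 + 1 by omega, Function.iterate_succ_apply', h] at h4
      exact A.g_ne_f b h4
  refine Finset.card_le_one.2 fun b hb c hc => ?_
  rw [Finset.mem_inter] at hb hc
  obtain ⟨i, hi, rfl⟩ := exists_iterate_of_mem_orbitFinset hx hb.1 hc.1
  rw [hx3] at hi
  have h3 := iterate_minimalPeriod_of_mem hx hb.1
  rw [hx3] at h3
  interval_cases i
  · rfl
  · exact (key b hb.2 hc.2).elim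
  · refine (key (A.f^[2] b) hc.2 ?_).elim
    rw [← Function.iterate_succ_apply' A.f, h3]
    exact hb.2

theorem eight_le_card {ι : Type*} (A : ArcSystem ι) [Fintype ι] [Nonempty ι] : 8 ≤ Fintype.card ι := by
  classical
  by_contra hlt
  obtain ⟨x₁, hx₁, x₂, hx₂, hx⟩ := A.exists_two_cycles
  obtain ⟨y₁, hy₁, y₂, hy₂, hy⟩ := A.dual.exists_two_cycles
  have px₁ := A.three_le_minimalPeriod hx₁
  have px₂ := A.three_le_minimalPeriod hx₂
  have py₁ := A.dual.three_le_minimalPeriod hy₁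
  have py₂ := A.dual.three_le_minimalPeriod hy₂
  change _ ∈ Function.periodicPts A.g at hy₁ hy₂
  change Disjoint (orbitFinset A.g y₁) (orbitFinset A.g y₂) at hy
  change 3 ≤ Function.minimalPeriod A.g _ at py₁ py₂
  have c1 := Finset.card_union_of_disjoint hx
  have c2 := Finset.card_union_of_disjoint hy
  have le (s : Finset ι) : s.card ≤ 7 := s.card_le_univ.trans (by omega)
  have l1 := le (orbitFinset A.f x₁ ∪ orbitFinset A.f x₂)
  have l2 := le (orbitFinset A.g y₁ ∪ orbitFinset A.g y₂)
  have inter {x y : ι} (h1 : x ∈ Function.periodicPts A.f) (h2 : y ∈ Function.periodicPts A.g)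
      (h3 : Function.minimalPeriod A.f x ≤ 4) (h4 : Function.minimalPeriod A.g y ≤ 4)
      (h : Function.minimalPeriod A.f x = 3 ∨ Function.minimalPeriod A.g y = 3) :
      (orbitFinset A.f x ∩ orbitFinset A.g y).card ≤ 1 := by
    rcases h with h | h
    · exact A.card_inter_le_one h1 h2 h h4
    · rw [Finset.inter_comm]
      exact A.dual.card_inter_le_one h2 h1 h h3
  have union (s t u : Finset ι) : s.card + (t ∪ u).card ≤ 7 + (s ∩ t).card + (s ∩ u).card := by
    have h1 := Finset.card_union_add_card_inter s (t ∪ u)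
    have h2 := Finset.card_union_le (s ∩ t) (s ∩ u)
    rw [← Finset.inter_union_distrib_left] at h2
    have := le (s ∪ (t ∪ u))
    omega
  -- One cycle of `g` has length 3, so it meets each cycle of `f` at most once; this forces both
  -- cycles of `f` to have length 3. Then all four intersections have at most one arc, and the two
  -- unions need at least 6 + 6 - 4 arcs.
  have u1 := union (orbitFinset A.g y₁) (orbitFinset A.f x₁) (orbitFinset A.f x₂)
  have u2 := union (orbitFinset A.g y₂) (orbitFinset A.f x₁) (orbitFinset A.f x₂)
  have u3 := union (orbitFinset A.f x₁ ∪ orbitFinset A.f x₂) (orbitFinset A.g y₁)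
    (orbitFinset A.g y₂)
  have u4 (t : Finset ι) := Finset.card_union_le (orbitFinset A.f x₁ ∩ t)
    (orbitFinset A.f x₂ ∩ t)
  simp only [← Finset.union_inter_distrib_right] at u4
  have u5 := u4 (orbitFinset A.g y₁)
  have u6 := u4 (orbitFinset A.g y₂)
  rw [Finset.inter_comm _ (orbitFinset A.f x₁), Finset.inter_comm _ (orbitFinset A.f x₂)] at u1 u2
  rw [card_orbitFinset, card_orbitFinset] at c1 c2
  rw [card_orbitFinset] at u1 u2
  have i11 := inter hx₁ hy₁ (by omega) (by omega)
  have i12 := inter hx₁ hy₂ (by omega) (by omega)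
  have i21 := inter hx₂ hy₁ (by omega) (by omega)
  have i22 := inter hx₂ hy₂ (by omega) (by omega)
  omega

end ArcSystem

/-! ### From occlusion diagrams to systems of oriented arcs -/

namespace GreatArc

variable {a b : GreatArc}

theorem relInterior_reverse (a : GreatArc) : a.reverse.relInterior = a.relInterior := by
  ext x
  constructor <;> rintro ⟨hx, s, t, hs, ht, h⟩ <;>
    exact ⟨hx, t, s, ht, hs, h.trans (add_comm _ _)⟩

theorem reverse_reverse (a : GreatArc) : a.reverse.reverse = a := rfl

theorem rightSide_reverse (a : GreatArc) : a.reverse.rightSide = a.leftSide := by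
  ext x
  change _ ∧ triple a.head a.tail x < 0 ↔ _ ∧ 0 < triple a.tail a.head x
  rw [triple_swap, neg_lt_zero]

theorem ne_reverse (a : GreatArc) : a ≠ a.reverse := fun h => a.ne (congrArg tail h)

theorem feedsInto_reverse_left : a.reverse.FeedsInto b ↔ a.FeedsInto b := or_comm

theorem feedsInto_reverse_right : a.FeedsInto b.reverse ↔ a.FeedsInto b := by
  unfold FeedsInto; rw [relInterior_reverse]

theorem triple_eq_zero {x : E3} (hx : x ∈ a.relInterior) : triple a.tail a.head x = 0 := by
  obtain ⟨-, s, t, -, -, rfl⟩ := hx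
  rw [triple_lin, triple_self_left, triple_self_right]; simp

theorem add_ne_zero (a : GreatArc) {s t : ℝ} (hs : 0 < s) (ht : 0 < t) :
    s • a.tail + t • a.head ≠ 0 := fun h => by
  have h1 : s • a.tail = -(t • a.head) := eq_neg_of_add_eq_zero_left h
  have h2 := congrArg norm h1
  rw [norm_neg, norm_smul, norm_smul, a.norm_tail, a.norm_head, mul_one, mul_one,
    Real.norm_of_nonneg hs.le, Real.norm_of_nonneg ht.le] at h2
  subst h2
  rw [← smul_neg] at h1
  exact a.ne_neg (smul_right_injective E3 hs.ne' h1)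

theorem exists_smul_mem_relInterior (a : GreatArc) {s t : ℝ} (hs : 0 < s) (ht : 0 < t) :
    ‖s • a.tail + t • a.head‖⁻¹ • (s • a.tail + t • a.head) ∈ a.relInterior := by
  have h := norm_pos_iff.2 (a.add_ne_zero hs ht)
  refine ⟨?_, ‖s • a.tail + t • a.head‖⁻¹ * s, ‖s • a.tail + t • a.head‖⁻¹ * t, by positivity,
    by positivity, by module⟩
  rw [norm_smul, norm_inv, norm_norm, inv_mul_cancel₀ h.ne']

theorem relInterior_nonempty (a : GreatArc) : a.relInterior.Nonempty :=
  ⟨_, a.exists_smul_mem_relInterior one_pos one_pos⟩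

end GreatArc

/-- A family of internally disjoint arcs, each feeding into two others and oriented so that all
arcs feeding into it reach it from its right. -/
structure IsOriented {ι : Type*} (A : ι → GreatArc) (f g : ι → ι) : Prop where
  head_mem : ∀ i, (A i).head ∈ (A (f i)).relInterior
  tail_mem : ∀ i, (A i).tail ∈ (A (g i)).relInterior
  head_side : ∀ i, (A i).tail ∈ (A (f i)).rightSide
  tail_side : ∀ i, (A i).head ∈ (A (g i)).rightSide
  disjoint : ∀ i j, i ≠ j → Disjoint (A i).relInterior (A j).relInterior

namespace IsOriented

variable {ι : Type*} {A : ι → GreatArc} {f g : ι → ι} (hA : IsOriented A f g)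
include hA

theorem eq_of_mem {i j : ι} {x : E3} (hi : x ∈ (A i).relInterior) (hj : x ∈ (A j).relInterior) :
    i = j := by
  by_contra h
  exact Set.disjoint_left.1 (hA.disjoint i j h) hi hj

theorem injective : Function.Injective A := fun i j h => by
  obtain ⟨x, hx⟩ := (A i).relInterior_nonempty
  exact hA.eq_of_mem hx (h ▸ hx)

theorem ne_reverse (i j : ι) : A i ≠ (A j).reverse := fun h => by
  obtain ⟨x, hx⟩ := (A i).relInterior_nonempty
  have hij := hA.eq_of_mem hx (j := j) (by rw [← GreatArc.relInterior_reverse, ← h]; exact hx)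
  exact (A i).ne_reverse (hij ▸ h)

/-- The underlying system of arcs. -/
def toArcSystem : ArcSystem ι where
  T i := (A i).tail
  H i := (A i).head
  f := f
  g := g
  head_mem i := (hA.head_mem i).2
  tail_mem i := (hA.tail_mem i).2
  head_side i := (hA.head_side i).2
  tail_side i := (hA.tail_side i).2
  disjoint i j s t s' t' hs ht hs' ht' h := by
    have h1 := (A i).exists_smul_mem_relInterior hs ht
    rw [h] at h1
    exact hA.eq_of_mem h1 ((A j).exists_smul_mem_relInterior hs' ht')

theorem f_ne_g (i : ι) : f i ≠ g i := (hA.toArcSystem.g_ne_f i).symm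

theorem feedsInto_iff {i j : ι} : (A i).FeedsInto (A j) ↔ j = f i ∨ j = g i := by
  constructor
  · rintro (h | h)
    · exact Or.inr (hA.eq_of_mem h (hA.tail_mem i))
    · exact Or.inl (hA.eq_of_mem h (hA.head_mem i))
  · rintro (rfl | rfl)
    · exact Or.inr (hA.head_mem i)
    · exact Or.inl (hA.tail_mem i)

theorem relInterior_subset {i j : ι} (h : (A i).FeedsInto (A j)) :
    (A i).relInterior ⊆ (A j).rightSide := by
  rintro x ⟨hx, s, t, hs, ht, rfl⟩
  refine ⟨hx, ?_⟩
  rw [triple_lin]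
  rcases hA.feedsInto_iff.1 h with rfl | rfl
  · rw [GreatArc.triple_eq_zero (hA.head_mem i), mul_zero, add_zero]
    exact mul_neg_of_pos_of_neg hs (hA.head_side i).2
  · rw [GreatArc.triple_eq_zero (hA.tail_mem i), mul_zero, zero_add]
    exact mul_neg_of_pos_of_neg ht (hA.tail_side i).2

theorem isSOD [Fintype ι] [Nonempty ι] [DecidableEq GreatArc] :
    IsSOD (Finset.univ.image A) where
  nonempty := Finset.univ_nonempty.image A
  internally_disjoint a ha b hb hab := by
    obtain ⟨i, -, rfl⟩ := Finset.mem_image.1 ha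
    obtain ⟨j, -, rfl⟩ := Finset.mem_image.1 hb
    exact hA.disjoint i j fun h => hab (h ▸ rfl)
  feeds_two a ha := by
    obtain ⟨i, -, rfl⟩ := Finset.mem_image.1 ha
    have : {b : GreatArc | b ∈ Finset.univ.image A ∧ (A i).FeedsInto b} = {A (f i), A (g i)} := by
      ext b
      simp only [Finset.mem_image, Finset.mem_univ, true_and, Set.mem_ofPred_eq,
        Set.mem_insert_iff, Set.mem_singleton_iff]
      constructor
      · rintro ⟨⟨j, rfl⟩, h⟩
        exact (hA.feedsInto_iff.1 h).imp (congrArg A) (congrArg A)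
      · rintro (rfl | rfl)
        · exact ⟨⟨_, rfl⟩, hA.feedsInto_iff.2 (Or.inl rfl)⟩
        · exact ⟨⟨_, rfl⟩, hA.feedsInto_iff.2 (Or.inr rfl)⟩
    rw [this, Set.ncard_pair (hA.injective.ne (hA.f_ne_g i))]
  same_side b hb := by
    obtain ⟨j, -, rfl⟩ := Finset.mem_image.1 hb
    refine Or.inr fun a ha h => ?_
    obtain ⟨i, -, rfl⟩ := Finset.mem_image.1 ha
    exact hA.relInterior_subset h

end IsOriented

namespace IsSOD

variable {S : Finset GreatArc} (hS : IsSOD S)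

open Classical in
/-- The arc `b`, oriented so that the arcs of `S` feeding into it reach it from its right. -/
noncomputable def orient (S : Finset GreatArc) (b : GreatArc) : GreatArc :=
  if ∀ a ∈ S, a.FeedsInto b → a.relInterior ⊆ b.rightSide then b else b.reverse

theorem relInterior_orient (S : Finset GreatArc) (b : GreatArc) :
    (orient S b).relInterior = b.relInterior := by
  unfold orient
  split_ifs
  exacts [rfl, b.relInterior_reverse]

include hS

theorem subset_rightSide_orient {a b : GreatArc} (ha : a ∈ S) (hb : b ∈ S) (h : a.FeedsInto b) :
    a.relInterior ⊆ (orient S b).rightSide := by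
  unfold orient
  split_ifs with hr
  · exact hr a ha h
  · rw [GreatArc.rightSide_reverse]
    exact (hS.same_side b hb).resolve_right hr a ha h

theorem eq_of_mem {a b : GreatArc} (ha : a ∈ S) (hb : b ∈ S) {x : E3} (hxa : x ∈ a.relInterior)
    (hxb : x ∈ b.relInterior) : a = b := by
  by_contra h
  exact Set.disjoint_left.1 (hS.internally_disjoint a ha b hb h) hxa hxb

/-- A point is interior to at most one arc, so two distinct arcs fed by `a` must take different ends
of `a`. -/
theorem exists_mem {a : GreatArc} (ha : a ∈ S) :
    (∃ b ∈ S, a.tail ∈ b.relInterior) ∧ ∃ b ∈ S, a.head ∈ b.relInterior := by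
  have h2 := hS.feeds_two a ha
  obtain ⟨b, c, hbc, h⟩ := Set.ncard_eq_two.1 h2
  have hb : b ∈ S ∧ a.FeedsInto b := h.symm.subset (Set.mem_insert b {c})
  have hc : c ∈ S ∧ a.FeedsInto c := h.symm.subset (Set.mem_insert_of_mem b rfl)
  obtain ⟨hbS, hb | hb⟩ := hb <;> obtain ⟨hcS, hc | hc⟩ := hc
  · exact absurd (hS.eq_of_mem hbS hcS hb hc) hbc
  · exact ⟨⟨b, hbS, hb⟩, ⟨c, hcS, hc⟩⟩
  · exact ⟨⟨c, hcS, hc⟩, ⟨b, hbS, hb⟩⟩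
  · exact absurd (hS.eq_of_mem hbS hcS hb hc) hbc

theorem exists_isOriented : ∃ f g : S → S, IsOriented (fun a : S => orient S a) f g := by
  have ex (a : S) : (∃ b : S, (orient S a).head ∈ (orient S b).relInterior) ∧
      ∃ b : S, (orient S a).tail ∈ (orient S b).relInterior := by
    obtain ⟨⟨b, hb, h1⟩, ⟨c, hc, h2⟩⟩ := hS.exists_mem a.2
    rw [← relInterior_orient S] at h1 h2
    have : orient S a = a.1 ∨ orient S a = a.1.reverse := by
      unfold orient; split_ifs <;> simp
    rcases this with h | h <;> rw [h]
    · exact ⟨⟨⟨c, hc⟩, h2⟩, ⟨⟨b, hb⟩, h1⟩⟩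
    · exact ⟨⟨⟨b, hb⟩, h1⟩, ⟨⟨c, hc⟩, h2⟩⟩
  choose f hf using fun a => (ex a).1
  choose g hg using fun a => (ex a).2
  have feeds (a b : S) (h : (orient S a).FeedsInto (orient S b)) : a.1.FeedsInto b.1 := by
    unfold orient at h
    split_ifs at h <;>
      simpa only [GreatArc.feedsInto_reverse_left, GreatArc.feedsInto_reverse_right] using h
  -- The sum of the ends points into the arc, hence to the right of `b`. As one end is in the plane
  -- of `b`, the other must be strictly to the right.
  have side (a b : S) (h : (orient S a).FeedsInto (orient S b)) :
      triple (orient S b).tail (orient S b).head ((orient S a).tail + (orient S a).head) < 0 := by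
    have h1 := (orient S a.1).exists_smul_mem_relInterior one_pos one_pos
    have hpos := norm_pos_iff.2 ((orient S a.1).add_ne_zero one_pos one_pos)
    have h2 := (hS.subset_rightSide_orient a.2 b.2 (feeds a b h)
      (relInterior_orient S a.1 ▸ h1)).2
    rw [one_smul, one_smul] at h2 hpos
    have h3 (r : ℝ) (x y z : E3) : triple x y (r • z) = r * triple x y z := by
      simpa using triple_lin x y z 0 r 0
    rw [h3] at h2
    by_contra hn
    exact absurd h2 (not_lt.2 (mul_nonneg (inv_nonneg.2 hpos.le) (not_lt.1 hn)))
  have add (x y u v : E3) : triple x y (u + v) = triple x y u + triple x y v := by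
    simpa using triple_lin x y u v 1 1
  refine ⟨f, g, hf, hg, fun a => ⟨(orient S a).norm_tail, ?_⟩,
    fun a => ⟨(orient S a).norm_head, ?_⟩, fun a b hab => ?_⟩
  · have := side a (f a) (Or.inr (hf a))
    rwa [add, GreatArc.triple_eq_zero (hf a), add_zero] at this
  · have := side a (g a) (Or.inl (hg a))
    rwa [add, GreatArc.triple_eq_zero (hg a), zero_add] at this
  · rw [relInterior_orient, relInterior_orient]
    exact hS.internally_disjoint a a.2 b b.2 fun h => hab (Subtype.ext h)

theorem eight_le_card : 8 ≤ S.card := by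
  obtain ⟨f, g, h⟩ := hS.exists_isOriented
  have : Nonempty S := hS.nonempty.to_subtype
  simpa using h.toArcSystem.eight_le_card

end IsSOD

/-! ### Swirls as cycles of the two maps -/

section Cycle

variable {α ι : Type*} {R : α → α → Prop}

theorem Cycle.exists_eq_cons {C : Cycle α} {x : α} (hx : x ∈ C) :
    ∃ l : List α, C = ((x :: l : List α) : Cycle α) := by
  induction C using Quotient.inductionOn' with
  | h l =>
    obtain ⟨s, t, rfl⟩ := List.append_of_mem (Cycle.mem_coe_iff.1 hx)
    exact ⟨t ++ s, Cycle.coe_eq_coe.2 List.isRotated_append⟩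

theorem Cycle.Chain.exists_rel {C : Cycle α} (hC : C.Chain R) {x : α} (hx : x ∈ C) :
    ∃ y ∈ C, R x y := by
  obtain ⟨l, rfl⟩ := Cycle.exists_eq_cons hx
  rw [Cycle.chain_coe_cons] at hC
  cases l with
  | nil => exact ⟨x, by simp, by simpa using hC⟩
  | cons y l =>
    rw [List.cons_append, List.isChain_cons_cons] at hC
    exact ⟨y, by simp, hC.1⟩

/-- A cycle along a relation that, on the elements of the cycle, amounts to a map `φ` is determined
by any 3-cycle of `φ` that it meets. -/
theorem Cycle.Chain.eq_of_three_cycle {C : Cycle α} (hC : C.Chain R) (hnd : C.Nodup) {B : ι → α}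
    {φ : ι → ι} (h : ∀ i, ∀ y ∈ C, R (B i) y → y = B (φ i)) {i : ι}
    (h1 : B (φ i) ≠ B i) (h2 : B (φ (φ i)) ≠ B i) (h3 : φ (φ (φ i)) = i) (hi : B i ∈ C) :
    C = (([B i, B (φ i), B (φ (φ i))] : List α) : Cycle α) := by
  obtain ⟨l, rfl⟩ := Cycle.exists_eq_cons hi
  rw [Cycle.chain_coe_cons] at hC
  rw [Cycle.nodup_coe_iff] at hnd
  simp only [Cycle.mem_coe_iff] at h
  match l with
  | [] =>
    exact absurd (h i (B i) (by simp) (by simpa using hC)).symm h1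
  | [y] =>
    simp only [List.cons_append, List.nil_append, List.isChain_cons_cons, List.isChain_singleton,
      and_true] at hC
    have hy := h i y (by simp) hC.1
    rw [hy] at hC
    exact absurd (h (φ i) (B i) (by simp) hC.2).symm h2
  | [y, z] =>
    simp only [List.cons_append, List.nil_append, List.isChain_cons_cons, List.isChain_singleton,
      and_true] at hC
    have hy := h i y (by simp) hC.1
    rw [hy] at hC
    rw [hy, h (φ i) z (by simp) hC.2.1]
  | y :: z :: u :: l =>
    simp only [List.cons_append, List.isChain_cons_cons] at hC
    have hy := h i y (by simp) hC.1
    rw [hy] at hC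
    have hz := h (φ i) z (by simp) hC.2.1
    rw [hz] at hC
    have hu := h (φ (φ i)) u (by simp) hC.2.2.1
    rw [h3] at hu
    simp [hu] at hnd

end Cycle

namespace GreatArc

variable {x y b : GreatArc}

/-- If `x` reaches `b` from the right and turns right, then it continues along `b`. -/
theorem TurnsRightInto.tail_left (h : x.TurnsRightInto y) (hb : y = b ∨ y = b.reverse)
    (hx : x.tail ∈ b.rightSide) : y = b := by
  rcases hb with rfl | rfl
  · rfl
  · obtain ⟨h1, h2⟩ := h
    rw [relInterior_reverse] at h1
    obtain ⟨-, s, t, hs, ht, h3⟩ := h1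
    have h4 : triple x.tail x.head b.tail < 0 := h2.2
    have h5 := hx.2
    rw [h3] at h4
    have h6 : triple x.tail (s • b.tail + t • b.head) b.tail = -t * triple b.tail b.head x.tail := by
      simp only [triple_apply, PiLp.add_apply, PiLp.smul_apply, smul_eq_mul]; ring
    rw [h6] at h4
    nlinarith

theorem turnsRightInto_of_mem (h : x.head ∈ b.relInterior) (hx : x.tail ∈ b.rightSide) :
    x.TurnsRightInto b := by
  refine ⟨h, b.norm_head, ?_⟩
  obtain ⟨-, s, t, hs, ht, h3⟩ := h
  have h6 : triple x.tail x.head b.head = s * triple b.tail b.head x.tail := by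
    rw [h3]
    simp only [triple_apply, PiLp.add_apply, PiLp.smul_apply, smul_eq_mul]; ring
  rw [h6]
  exact mul_neg_of_pos_of_neg hs hx.2

theorem TurnsLeftInto.tail_right (h : x.TurnsLeftInto y) (hb : y = b ∨ y = b.reverse)
    (hx : x.tail ∈ b.rightSide) : y = b.reverse := by
  rcases hb with rfl | rfl
  · obtain ⟨h1, h2⟩ := h
    obtain ⟨-, s, t, hs, ht, h3⟩ := h1
    have h4 : 0 < triple x.tail x.head y.head := h2.2
    have h5 := hx.2
    rw [h3] at h4
    have h6 : triple x.tail (s • y.tail + t • y.head) y.head =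
        s * triple y.tail y.head x.tail := by
      simp only [triple_apply, PiLp.add_apply, PiLp.smul_apply, smul_eq_mul]; ring
    rw [h6] at h4
    nlinarith
  · rfl

theorem turnsLeftInto_of_mem (h : x.head ∈ b.relInterior) (hx : x.tail ∈ b.rightSide) :
    x.TurnsLeftInto b.reverse := by
  refine ⟨by rwa [relInterior_reverse], b.norm_tail, ?_⟩
  obtain ⟨-, s, t, hs, ht, h3⟩ := h
  have h6 : triple x.tail x.head b.reverse.head = -t * triple b.tail b.head x.tail := by
    rw [h3]
    simp only [reverse, triple_apply, PiLp.add_apply, PiLp.smul_apply, smul_eq_mul]; ring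
  rw [h6]
  have := hx.2
  nlinarith

end GreatArc

namespace IsOriented

variable {ι : Type*} {A : ι → GreatArc} {f g : ι → ι} (hA : IsOriented A f g)
include hA

/-- A traversal that ends in the arc `A j` reaches it from the right. -/
theorem tail_mem_rightSide {x : GreatArc} {i j : ι} (hx : x = A i ∨ x = (A i).reverse)
    (h : x.head ∈ (A j).relInterior) : x.tail ∈ (A j).rightSide := by
  rcases hx with rfl | rfl
  · rw [hA.eq_of_mem h (hA.head_mem i)]
    exact hA.head_side i
  · rw [hA.eq_of_mem h (hA.tail_mem i)]
    exact hA.tail_side i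

theorem eq_of_turnsRightInto {x y : GreatArc} {i j : ι} (hx : x = A i ∨ x = (A i).reverse)
    (hy : y = A j ∨ y = (A j).reverse) (h : x.TurnsRightInto y) : y = A j := by
  have h1 : x.head ∈ (A j).relInterior := by
    rcases hy with rfl | rfl
    · exact h.1
    · exact (A j).relInterior_reverse ▸ h.1
  exact h.tail_left hy (hA.tail_mem_rightSide hx h1)

theorem eq_of_turnsLeftInto {x y : GreatArc} {i j : ι} (hx : x = A i ∨ x = (A i).reverse)
    (hy : y = A j ∨ y = (A j).reverse) (h : x.TurnsLeftInto y) : y = (A j).reverse := by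
  have h1 : x.head ∈ (A j).relInterior := by
    rcases hy with rfl | rfl
    · exact h.1
    · exact (A j).relInterior_reverse ▸ h.1
  exact h.tail_right hy (hA.tail_mem_rightSide hx h1)

theorem turnsRightInto (i : ι) : (A i).TurnsRightInto (A (f i)) :=
  GreatArc.turnsRightInto_of_mem (hA.head_mem i) (hA.head_side i)

theorem turnsLeftInto (i : ι) : (A i).reverse.TurnsLeftInto (A (g i)).reverse :=
  GreatArc.turnsLeftInto_of_mem (hA.tail_mem i) (hA.tail_side i)

/-- The clockwise swirl along a 3-cycle of `f`. -/
theorem isSwirl_right [Fintype ι] [DecidableEq GreatArc] {i : ι} (h : f (f (f i)) = i) :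
    IsSwirl (Finset.univ.image A) (([A i, A (f i), A (f (f i))] : List GreatArc) : Cycle _) := by
  have n1 (j : ι) : A j ≠ A (f j) := hA.injective.ne (hA.toArcSystem.f_ne_self j).symm
  have n2 (j : ι) : A j ≠ A (f (f j)) := hA.injective.ne (hA.toArcSystem.f_f_ne_self j).symm
  refine ⟨by simp [Cycle.coe_eq_nil], ?_, ?_, Or.inr ?_⟩
  · simp [n1, n2]
  · intro a ha
    simp only [Cycle.mem_coe_iff, List.mem_cons, List.not_mem_nil, or_false] at ha
    left
    rcases ha with rfl | rfl | rfl <;> exact Finset.mem_image_of_mem A (Finset.mem_univ _)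
  · have h3 := hA.turnsRightInto (f (f i))
    rw [h] at h3
    simp [Cycle.chain_coe_cons, hA.turnsRightInto, h3]

/-- The counterclockwise swirl along a 3-cycle of `g`. -/
theorem isSwirl_left [Fintype ι] [DecidableEq GreatArc] {i : ι} (h : g (g (g i)) = i) :
    IsSwirl (Finset.univ.image A)
      (([(A i).reverse, (A (g i)).reverse, (A (g (g i))).reverse] : List GreatArc) : Cycle _) := by
  have inj : Function.Injective fun j => (A j).reverse := fun j k hjk =>
    hA.injective (congrArg GreatArc.reverse hjk)
  have n1 (j : ι) : (A j).reverse ≠ (A (g j)).reverse :=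
    inj.ne (hA.toArcSystem.dual.f_ne_self j).symm
  have n2 (j : ι) : (A j).reverse ≠ (A (g (g j))).reverse :=
    inj.ne (hA.toArcSystem.dual.f_f_ne_self j).symm
  refine ⟨by simp [Cycle.coe_eq_nil], ?_, ?_, Or.inl ?_⟩
  · simp [n1, n2]
  · intro a ha
    simp only [Cycle.mem_coe_iff, List.mem_cons, List.not_mem_nil, or_false] at ha
    right
    rcases ha with rfl | rfl | rfl <;> exact Finset.mem_image_of_mem A (Finset.mem_univ _)
  · have h3 := hA.turnsLeftInto (g (g i))
    rw [h] at h3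
    simp [Cycle.chain_coe_cons, hA.turnsLeftInto, h3]

/-- If every orbit of `f` and of `g` ends in one of two given 3-cycles, then these four 3-cycles
yield all swirls. -/
theorem isSwirl_iff [Fintype ι] [DecidableEq GreatArc] {i i' j j' : ι} (hi : f (f (f i)) = i)
    (hi' : f (f (f i')) = i') (hj : g (g (g j)) = j) (hj' : g (g (g j')) = j')
    (hf : ∀ k, ∃ n, f^[n] k = i ∨ f^[n] k = i') (hg : ∀ k, ∃ n, g^[n] k = j ∨ g^[n] k = j')
    (C : Cycle GreatArc) : IsSwirl (Finset.univ.image A) C ↔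
      C = (([A i, A (f i), A (f (f i))] : List GreatArc) : Cycle _) ∨
      C = (([A i', A (f i'), A (f (f i'))] : List GreatArc) : Cycle _) ∨
      C = (([(A j).reverse, (A (g j)).reverse, (A (g (g j))).reverse] : List GreatArc) :
        Cycle _) ∨
      C = (([(A j').reverse, (A (g j')).reverse, (A (g (g j'))).reverse] : List GreatArc) :
        Cycle _) := by
  constructor
  · rintro ⟨hne, hnd, hmem, hC⟩
    have hmem' : ∀ a ∈ C, ∃ k, a = A k ∨ a = (A k).reverse := by
      intro a ha
      rcases hmem a ha with h | h <;> obtain ⟨k, -, hk⟩ := Finset.mem_image.1 h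
      · exact ⟨k, Or.inl hk.symm⟩
      · exact ⟨k, Or.inr (by rw [hk, GreatArc.reverse_reverse])⟩
    obtain ⟨x, hx⟩ : ∃ x, x ∈ C := by
      induction C using Quotient.inductionOn' with
      | h l =>
        cases l with
        | nil => exact absurd rfl hne
        | cons a l => exact ⟨a, Cycle.mem_coe_iff.2 (by simp)⟩
    obtain ⟨k, hk⟩ := hmem' x hx
    rcases hC with hC | hC
    -- The direction of `x` is unknown, but a left turn fixes that of its successor `y`: against the
    -- orientation. From `y` on, the cycle follows `g`.
    · obtain ⟨y, hy, hxy⟩ := hC.exists_rel hx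
      obtain ⟨l, hl⟩ := hmem' y hy
      have hyl := hA.eq_of_turnsLeftInto hk hl hxy
      have step (m : ι) (z : GreatArc) (hz : z ∈ C) (h : (A m).reverse.TurnsLeftInto z) :
          z = (A (g m)).reverse := by
        obtain ⟨q, hq⟩ := hmem' z hz
        have h1 := hA.eq_of_turnsLeftInto (Or.inr rfl) hq h
        have h2 := h.1
        rw [h1, GreatArc.relInterior_reverse] at h2
        rw [h1, hA.eq_of_mem h2 (hA.tail_mem m)]
      have iter (n : ℕ) : (A (g^[n] l)).reverse ∈ C := by
        induction n with
        | zero => exact hyl ▸ hy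
        | succ n ih =>
          obtain ⟨z, hz, h⟩ := hC.exists_rel ih
          rw [Function.iterate_succ_apply', ← step _ z hz h]
          exact hz
      have inj : Function.Injective fun j => (A j).reverse := fun j k hjk =>
        hA.injective (congrArg GreatArc.reverse hjk)
      obtain ⟨n, hn | hn⟩ := hg l
      · exact Or.inr (Or.inr (Or.inl (hC.eq_of_three_cycle (B := fun m => (A m).reverse) hnd step
          (inj.ne (hA.toArcSystem.dual.f_ne_self j))
          (inj.ne (hA.toArcSystem.dual.f_f_ne_self j)) hj (hn ▸ iter n))))
      · exact Or.inr (Or.inr (Or.inr (hC.eq_of_three_cycle (B := fun m => (A m).reverse) hnd step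
          (inj.ne (hA.toArcSystem.dual.f_ne_self j'))
          (inj.ne (hA.toArcSystem.dual.f_f_ne_self j')) hj' (hn ▸ iter n))))
    -- Likewise a right turn puts `y` along the orientation, and the cycle follows `f`.
    · obtain ⟨y, hy, hxy⟩ := hC.exists_rel hx
      obtain ⟨l, hl⟩ := hmem' y hy
      have hyl := hA.eq_of_turnsRightInto hk hl hxy
      have step (m : ι) (z : GreatArc) (hz : z ∈ C) (h : (A m).TurnsRightInto z) :
          z = A (f m) := by
        obtain ⟨q, hq⟩ := hmem' z hz
        have h1 := hA.eq_of_turnsRightInto (Or.inl rfl) hq h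
        have h2 := h.1
        rw [h1] at h2
        rw [h1, hA.eq_of_mem h2 (hA.head_mem m)]
      have iter (n : ℕ) : A (f^[n] l) ∈ C := by
        induction n with
        | zero => exact hyl ▸ hy
        | succ n ih =>
          obtain ⟨z, hz, h⟩ := hC.exists_rel ih
          rw [Function.iterate_succ_apply', ← step _ z hz h]
          exact hz
      obtain ⟨n, hn | hn⟩ := hf l
      · exact Or.inl (hC.eq_of_three_cycle (B := A) hnd step
          (hA.injective.ne (hA.toArcSystem.f_ne_self i))
          (hA.injective.ne (hA.toArcSystem.f_f_ne_self i)) hi (hn ▸ iter n))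
      · exact Or.inr (Or.inl (hC.eq_of_three_cycle (B := A) hnd step
          (hA.injective.ne (hA.toArcSystem.f_ne_self i'))
          (hA.injective.ne (hA.toArcSystem.f_f_ne_self i')) hi' (hn ▸ iter n)))
  · rintro (rfl | rfl | rfl | rfl)
    exacts [hA.isSwirl_right hi, hA.isSwirl_right hi', hA.isSwirl_left hj, hA.isSwirl_left hj']

/-- Two swirls are told apart by a member of only one of them; a clockwise and a counterclockwise
one differ as no oriented arc is the reverse of another. -/
theorem ncard_isSwirl [Fintype ι] [DecidableEq GreatArc] {i i' j j' : ι} (hi : f (f (f i)) = i)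
    (hi' : f (f (f i')) = i') (hj : g (g (g j)) = j) (hj' : g (g (g j')) = j')
    (hf : ∀ k, ∃ n, f^[n] k = i ∨ f^[n] k = i') (hg : ∀ k, ∃ n, g^[n] k = j ∨ g^[n] k = j')
    (hii : i ≠ i' ∧ i ≠ f i' ∧ i ≠ f (f i')) (hjj : j ≠ j' ∧ j ≠ g j' ∧ j ≠ g (g j')) :
    {C : Cycle GreatArc | IsSwirl (Finset.univ.image A) C}.ncard = 4 := by
  have ne {x : GreatArc} {l l' : List GreatArc} (h : x ∈ l) (h' : x ∉ l') :
      (l : Cycle GreatArc) ≠ (l' : Cycle GreatArc) := fun e => h' (by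
    rw [← Cycle.mem_coe_iff, ← e]; exact Cycle.mem_coe_iff.2 h)
  have inj : Function.Injective fun j => (A j).reverse := fun j k hjk =>
    hA.injective (congrArg GreatArc.reverse hjk)
  simp only [hA.isSwirl_iff hi hi' hj hj' hf hg]
  change ({_, _, _, _} : Set (Cycle GreatArc)).ncard = 4
  rw [Set.ncard_insert_of_notMem, Set.ncard_insert_of_notMem, Set.ncard_pair]
  · refine ne (x := (A j).reverse) (by simp) ?_
    simpa [inj.eq_iff] using hjj
  · simp only [Set.mem_insert_iff, Set.mem_singleton_iff, not_or]
    exact ⟨ne (x := A i') (by simp) (by simp [hA.ne_reverse]),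
      ne (x := A i') (by simp) (by simp [hA.ne_reverse])⟩
  · simp only [Set.mem_insert_iff, Set.mem_singleton_iff, not_or]
    exact ⟨ne (x := A i) (by simp) (by simpa [hA.injective.eq_iff] using hii),
      ne (x := A i) (by simp) (by simp [hA.ne_reverse]),
      ne (x := A i) (by simp) (by simp [hA.ne_reverse])⟩

end IsOriented

/-! ### The example with eight arcs -/

/-- The triple product of integer vectors. -/
def intTriple (x y z : Fin 3 → ℤ) : ℤ :=
  x 0 * (y 1 * z 2 - y 2 * z 1) - x 1 * (y 0 * z 2 - y 2 * z 0)
    + x 2 * (y 0 * z 1 - y 1 * z 0)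

/-- The dot product of integer vectors. -/
def intDot (x y : Fin 3 → ℤ) : ℤ := x 0 * y 0 + x 1 * y 1 + x 2 * y 2

/-- An integer vector as a point of Euclidean space. -/
noncomputable def realVec (v : Fin 3 → ℤ) : E3 := WithLp.toLp 2 fun i => (v i : ℝ)

theorem realVec_apply (v : Fin 3 → ℤ) (i : Fin 3) : realVec v i = v i := rfl

theorem triple_realVec (x y z : Fin 3 → ℤ) :
    triple (realVec x) (realVec y) (realVec z) = intTriple x y z := by
  simp only [triple_apply, realVec_apply, intTriple]; push_cast; ring

theorem triple_smul_smul_smul (r s t : ℝ) (x y z : E3) :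
    triple (r • x) (s • y) (t • z) = r * s * t * triple x y z := by
  simp only [triple_apply, PiLp.smul_apply, smul_eq_mul]; ring

theorem realVec_ne_zero {u v w : Fin 3 → ℤ} (h : intTriple u v w ≠ 0) :
    realVec v ≠ 0 ∧ realVec w ≠ 0 := by
  have h1 : triple (realVec u) (realVec v) (realVec w) ≠ 0 := by
    rw [triple_realVec]; exact_mod_cast h
  constructor <;> intro h2 <;> refine h1 ?_ <;> rw [h2] <;> simp [triple_apply]

/-- The arc between the directions of two linearly independent integer vectors. -/
noncomputable def GreatArc.ofInt (v w : Fin 3 → ℤ) (h : ∃ u, intTriple u v w ≠ 0) : GreatArc where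
  tail := ‖realVec v‖⁻¹ • realVec v
  head := ‖realVec w‖⁻¹ • realVec w
  norm_tail := by
    obtain ⟨u, h⟩ := h
    rw [norm_smul, norm_inv, norm_norm, inv_mul_cancel₀ (norm_ne_zero_iff.2 (realVec_ne_zero h).1)]
  norm_head := by
    obtain ⟨u, h⟩ := h
    rw [norm_smul, norm_inv, norm_norm, inv_mul_cancel₀ (norm_ne_zero_iff.2 (realVec_ne_zero h).2)]
  ne e := by
    obtain ⟨u, h⟩ := h
    have hv := inv_ne_zero (norm_ne_zero_iff.2 (realVec_ne_zero h).1)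
    have hw := inv_ne_zero (norm_ne_zero_iff.2 (realVec_ne_zero h).2)
    have h1 := triple_smul_smul_smul 1 ‖realVec v‖⁻¹ ‖realVec w‖⁻¹
      (realVec u) (realVec v) (realVec w)
    rw [e, triple_self_right, triple_realVec] at h1
    have : (intTriple u v w : ℝ) ≠ 0 := by exact_mod_cast h
    exact mul_ne_zero (mul_ne_zero (mul_ne_zero one_ne_zero hv) hw) this h1.symm
  ne_neg e := by
    obtain ⟨u, h⟩ := h
    have hv := inv_ne_zero (norm_ne_zero_iff.2 (realVec_ne_zero h).1)
    have hw := inv_ne_zero (norm_ne_zero_iff.2 (realVec_ne_zero h).2)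
    have h1 := triple_smul_smul_smul 1 ‖realVec v‖⁻¹ ‖realVec w‖⁻¹
      (realVec u) (realVec v) (realVec w)
    have h2 (x y : E3) : triple x (-y) y = 0 := by
      simp only [triple_apply, PiLp.neg_apply]; ring
    rw [e, h2, triple_realVec] at h1
    have : (intTriple u v w : ℝ) ≠ 0 := by exact_mod_cast h
    exact mul_ne_zero (mul_ne_zero (mul_ne_zero one_ne_zero hv) hw) this h1.symm

namespace GreatArc

variable {v w x y : Fin 3 → ℤ} (h : ∃ u, intTriple u v w ≠ 0)

theorem norm_realVec_pos (h : ∃ u, intTriple u v w ≠ 0) : 0 < ‖realVec v‖ ∧ 0 < ‖realVec w‖ := by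
  obtain ⟨u, h⟩ := h
  exact ⟨norm_pos_iff.2 (realVec_ne_zero h).1, norm_pos_iff.2 (realVec_ne_zero h).2⟩

theorem mem_relInterior_ofInt {D p q : ℤ} (hx : realVec x ≠ 0) (hD : 0 < D) (hp : 0 < p)
    (hq : 0 < q) (e : ∀ i, D * x i = p * v i + q * w i) :
    ‖realVec x‖⁻¹ • realVec x ∈ (ofInt v w h).relInterior := by
  obtain ⟨hv, hw⟩ := norm_realVec_pos h
  have hx' := norm_pos_iff.2 hx
  have hD' : (0 : ℝ) < D := by exact_mod_cast hD
  have hp' : (0 : ℝ) < p := by exact_mod_cast hp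
  have hq' : (0 : ℝ) < q := by exact_mod_cast hq
  refine ⟨by rw [norm_smul, norm_inv, norm_norm, inv_mul_cancel₀ hx'.ne'],
    ‖realVec x‖⁻¹ * (D : ℝ)⁻¹ * p * ‖realVec v‖, ‖realVec x‖⁻¹ * (D : ℝ)⁻¹ * q * ‖realVec w‖,
    by positivity, by positivity, ?_⟩
  have e' : realVec x = (D : ℝ)⁻¹ • ((p : ℝ) • realVec v + (q : ℝ) • realVec w) := by
    have e1 : (D : ℝ) • realVec x = (p : ℝ) • realVec v + (q : ℝ) • realVec w := by
      ext i
      simp only [PiLp.add_apply, PiLp.smul_apply, smul_eq_mul, realVec_apply]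
      exact_mod_cast e i
    rw [← e1, smul_smul, inv_mul_cancel₀ hD'.ne', one_smul]
  simp only [ofInt, smul_smul]
  rw [mul_assoc _ ‖realVec v‖, mul_inv_cancel₀ hv.ne', mul_one,
    mul_assoc _ ‖realVec w‖, mul_inv_cancel₀ hw.ne', mul_one]
  nth_rewrite 2 [e']
  module

theorem mem_rightSide_ofInt (hx : realVec x ≠ 0) (e : intTriple v w x < 0) :
    ‖realVec x‖⁻¹ • realVec x ∈ (ofInt v w h).rightSide := by
  obtain ⟨hv, hw⟩ := norm_realVec_pos h
  have hx' := norm_pos_iff.2 hx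
  refine ⟨by rw [norm_smul, norm_inv, norm_norm, inv_mul_cancel₀ hx'.ne'], ?_⟩
  have e' : (intTriple v w x : ℝ) < 0 := by exact_mod_cast e
  simp only [ofInt]
  rw [triple_smul_smul_smul, triple_realVec]
  exact mul_neg_of_pos_of_neg (by positivity) e'

/-- Arcs that are weakly separated by a plane through the origin, which does not contain both, are
internally disjoint. -/
theorem disjoint_ofInt (h' : ∃ u, intTriple u x y ≠ 0) {u : Fin 3 → ℤ}
    (hv : 0 ≤ intDot u v) (hw : 0 ≤ intDot u w) (hx : intDot u x ≤ 0) (hy : intDot u y ≤ 0)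
    (hne : 0 < intDot u v + intDot u w - intDot u x - intDot u y) :
    Disjoint (ofInt v w h).relInterior (ofInt x y h').relInterior := by
  rw [Set.disjoint_left]
  rintro z ⟨-, s, t, hs, ht, e⟩ ⟨-, s', t', hs', ht', e'⟩
  obtain ⟨nv, nw⟩ := norm_realVec_pos h
  obtain ⟨nx, ny⟩ := norm_realVec_pos h'
  let φ (z : E3) : ℝ := u 0 * z 0 + u 1 * z 1 + u 2 * z 2
  have hφ (v w : Fin 3 → ℤ) (s t : ℝ) : φ (s • (‖realVec v‖⁻¹ • realVec v) +
      t • (‖realVec w‖⁻¹ • realVec w)) =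
      s * ‖realVec v‖⁻¹ * (intDot u v : ℤ) + t * ‖realVec w‖⁻¹ * (intDot u w : ℤ) := by
    simp only [φ, PiLp.add_apply, PiLp.smul_apply, smul_eq_mul, realVec_apply, intDot]
    push_cast; ring
  have e1 := (congrArg φ e).symm.trans (congrArg φ e')
  simp only [ofInt] at e1
  rw [hφ, hφ] at e1
  have c1 : 0 < s * ‖realVec v‖⁻¹ := by positivity
  have c2 : 0 < t * ‖realVec w‖⁻¹ := by positivity
  have c3 : 0 < s' * ‖realVec x‖⁻¹ := by positivity
  have c4 : 0 < t' * ‖realVec y‖⁻¹ := by positivity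
  have hv' : (0 : ℝ) ≤ (intDot u v : ℤ) := by exact_mod_cast hv
  have hw' : (0 : ℝ) ≤ (intDot u w : ℤ) := by exact_mod_cast hw
  have hx' : ((intDot u x : ℤ) : ℝ) ≤ 0 := by exact_mod_cast hx
  have hy' : ((intDot u y : ℤ) : ℝ) ≤ 0 := by exact_mod_cast hy
  have d1 := mul_nonneg c1.le hv'
  have d2 := mul_nonneg c2.le hw'
  have d3 := mul_nonpos_of_nonneg_of_nonpos c3.le hx'
  have d4 := mul_nonpos_of_nonneg_of_nonpos c4.le hy'
  -- The value of `φ` at the common point is both nonnegative and nonpositive, so every term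
  -- vanishes, against `hne`.
  have z1 : ((intDot u v : ℤ) : ℝ) = 0 := by
    have : s * ‖realVec v‖⁻¹ * (intDot u v : ℤ) = 0 := by linarith
    exact (mul_eq_zero.1 this).resolve_left c1.ne'
  have z2 : ((intDot u w : ℤ) : ℝ) = 0 := by
    have : t * ‖realVec w‖⁻¹ * (intDot u w : ℤ) = 0 := by linarith
    exact (mul_eq_zero.1 this).resolve_left c2.ne'
  have z3 : ((intDot u x : ℤ) : ℝ) = 0 := by
    have : s' * ‖realVec x‖⁻¹ * (intDot u x : ℤ) = 0 := by linarith
    exact (mul_eq_zero.1 this).resolve_left c3.ne'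
  have z4 : ((intDot u y : ℤ) : ℝ) = 0 := by
    have : t' * ‖realVec y‖⁻¹ * (intDot u y : ℤ) = 0 := by linarith
    exact (mul_eq_zero.1 this).resolve_left c4.ne'
  rw [Int.cast_eq_zero] at z1 z2 z3 z4
  omega

end GreatArc

/-! A diagram with eight arcs. It is symmetric under the rotary reflection
`(x, y, z) ↦ (-y, x, -z)`, which permutes the first four arcs and the last four arcs. -/

/-- The directions of the tails. -/
def octTail : Fin 8 → Fin 3 → ℤ :=
  ![![5, 25, -13], ![-1, -9, -5], ![-5, -25, -13], ![1, 9, -5],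
    ![1, 11, -5], ![14, 1, 5], ![-1, -11, -5], ![-14, -1, 5]]

/-- The directions of the heads. -/
def octHead : Fin 8 → Fin 3 → ℤ :=
  ![![-9, 1, 5], ![-25, 5, 13], ![9, -1, 5], ![25, -5, 13],
    ![1, -14, -5], ![-11, 1, 5], ![-1, 14, -5], ![11, -1, 5]]

/-- The arcs that contain the heads. -/
def octF : Fin 8 → Fin 8 := ![5, 0, 7, 2, 2, 1, 0, 3]

/-- The arcs that contain the tails. -/
def octG : Fin 8 → Fin 8 := ![3, 6, 1, 4, 0, 3, 2, 1]

/-- Coefficients that express the heads by the endpoints of the arcs containing them. -/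
def octHeadCoeff : Fin 8 → Fin 3 → ℤ :=
  ![![25, 2, 23], ![23, 2, 65], ![25, 2, 23], ![23, 2, 65],
    ![46, 25, 19], ![23, 3, 10], ![46, 25, 19], ![23, 3, 10]]

/-- Coefficients that express the tails by the endpoints of the arcs containing them. -/
def octTailCoeff : Fin 8 → Fin 3 → ℤ :=
  ![![23, 65, 2], ![25, 23, 2], ![23, 65, 2], ![25, 23, 2],
    ![23, 10, 3], ![46, 19, 25], ![23, 10, 3], ![46, 19, 25]]

/-- Normals of planes that separate the arcs. -/
def octNormal : Fin 9 → Fin 3 → ℤ :=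
  ![![-5, 0, -1], ![0, -5, 1], ![0, 0, -1], ![3, 2, 5], ![-2, 3, -5], ![-3, -2, 5],
    ![2, -3, -5], ![5, 0, -1], ![0, 5, 1]]

theorem octArc_indep (i : Fin 8) : ∃ u, intTriple u (octTail i) (octHead i) ≠ 0 := by
  have h : ∀ i, ∃ j : Fin 3, intTriple (fun k => if k = j then 1 else 0)
    (octTail i) (octHead i) ≠ 0 := by decide
  exact (h i).imp' _ fun _ hj => hj

/-- The arcs of the diagram. -/
noncomputable def octArc (i : Fin 8) : GreatArc :=
  GreatArc.ofInt (octTail i) (octHead i) (octArc_indep i)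

theorem octArc_separated : ∀ i j : Fin 8, i ≠ j → ∃ m : Fin 9,
    (0 ≤ intDot (octNormal m) (octTail i) ∧ 0 ≤ intDot (octNormal m) (octHead i) ∧
      intDot (octNormal m) (octTail j) ≤ 0 ∧ intDot (octNormal m) (octHead j) ≤ 0 ∧
      0 < intDot (octNormal m) (octTail i) + intDot (octNormal m) (octHead i) -
        intDot (octNormal m) (octTail j) - intDot (octNormal m) (octHead j)) ∨
    (0 ≤ intDot (octNormal m) (octTail j) ∧ 0 ≤ intDot (octNormal m) (octHead j) ∧
      intDot (octNormal m) (octTail i) ≤ 0 ∧ intDot (octNormal m) (octHead i) ≤ 0 ∧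
      0 < intDot (octNormal m) (octTail j) + intDot (octNormal m) (octHead j) -
        intDot (octNormal m) (octTail i) - intDot (octNormal m) (octHead i)) := by
  decide +kernel

theorem octHead_coeff : ∀ i, 0 < octHeadCoeff i 0 ∧ 0 < octHeadCoeff i 1 ∧
    0 < octHeadCoeff i 2 ∧ ∀ k, octHeadCoeff i 0 * octHead i k =
      octHeadCoeff i 1 * octTail (octF i) k + octHeadCoeff i 2 * octHead (octF i) k := by
  decide +kernel

theorem octTail_coeff : ∀ i, 0 < octTailCoeff i 0 ∧ 0 < octTailCoeff i 1 ∧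
    0 < octTailCoeff i 2 ∧ ∀ k, octTailCoeff i 0 * octTail i k =
      octTailCoeff i 1 * octTail (octG i) k + octTailCoeff i 2 * octHead (octG i) k := by
  decide +kernel

theorem octTail_side : ∀ i, intTriple (octTail (octF i)) (octHead (octF i)) (octTail i) < 0 := by
  decide +kernel

theorem octHead_side : ∀ i, intTriple (octTail (octG i)) (octHead (octG i)) (octHead i) < 0 := by
  decide +kernel

theorem isOriented_octArc : IsOriented octArc octF octG := by
  have hT (i : Fin 8) : realVec (octTail i) ≠ 0 :=
    norm_pos_iff.1 (GreatArc.norm_realVec_pos (octArc_indep i)).1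
  have hH (i : Fin 8) : realVec (octHead i) ≠ 0 :=
    norm_pos_iff.1 (GreatArc.norm_realVec_pos (octArc_indep i)).2
  refine ⟨fun i => ?_, fun i => ?_, fun i => ?_, fun i => ?_, fun i j hij => ?_⟩
  · obtain ⟨h0, h1, h2, h⟩ := octHead_coeff i
    exact GreatArc.mem_relInterior_ofInt _ (hH i) h0 h1 h2 h
  · obtain ⟨h0, h1, h2, h⟩ := octTail_coeff i
    exact GreatArc.mem_relInterior_ofInt _ (hT i) h0 h1 h2 h
  · exact GreatArc.mem_rightSide_ofInt _ (hT i) (octTail_side i)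
  · exact GreatArc.mem_rightSide_ofInt _ (hH i) (octHead_side i)
  · obtain ⟨m, ⟨h1, h2, h3, h4, h5⟩ | ⟨h1, h2, h3, h4, h5⟩⟩ := octArc_separated i j hij
    · exact GreatArc.disjoint_ofInt _ _ h1 h2 h3 h4 h5
    · exact (GreatArc.disjoint_ofInt _ _ h1 h2 h3 h4 h5).symm

theorem corollary8 :
    (∀ S : Finset GreatArc, IsSOD S → 8 ≤ S.card) ∧
    (∃ S : Finset GreatArc, IsSOD S ∧ S.card = 8 ∧
      {C : Cycle GreatArc | IsSwirl S C}.ncard = 4) := by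
  classical
  refine ⟨fun S hS => hS.eight_le_card, Finset.univ.image octArc, isOriented_octArc.isSOD, ?_, ?_⟩
  · rw [Finset.card_image_of_injective _ isOriented_octArc.injective]; rfl
  · have hf : ∀ k, ∃ n : Fin 4, octF^[n] k = 0 ∨ octF^[n] k = 2 := by decide
    have hg : ∀ k, ∃ n : Fin 4, octG^[n] k = 0 ∨ octG^[n] k = 1 := by decide
    exact isOriented_octArc.ncard_isSwirl (i := 0) (i' := 2) (j := 0) (j' := 1) (by decide)
      (by decide) (by decide) (by decide) (fun k => (hf k).imp' _ fun _ h => h)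
      (fun k => (hg k).imp' _ fun _ h => h) (by decide) (by decide)
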